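/- Let $\mathbb{F}$ be a finite field, an algebraically closed field, or (a field isomorphic to) the field of real numbers, let $r\ge 1$, and let $V=\mathbb{F}^2\otimes\mathbb{F}^3\otimes\mathbb{F}^r$. A \emph{fundamental tensor} is a tensor $a\otimes b\otimes c$ with $a,b,c$ nonzero, and the \emph{tensor rank} of $A\in V$ is the least $k$ such that $A$ lies in the span of $k$ fundamental tensors. Let $H=\mathrm{GL}(\mathbb{F}^2)\times\mathrm{GL}(\mathbb{F}^3)\times\mathrm{GL}(\mathbb{F}^r)$ act on $V$ in the natural way. The \emph{third contraction space} $A_3\le\mathbb{F}^2\otimes\mathbb{F}^3$ of $A$ is spanned by the contractions $w(A)$, $w\in(\mathbb{F}^r)^\vee$, where $w(a\otimes b\otimes c)=w(c)\,a\otimes b$. Write $e_{ij}=e_i\otimes e_j\in\mathbb{F}^2\otimes\mathbb{F}^3$, and let $\perp$ denote the orthogonal space with respect to the bilinear form on $\mathbb{F}^2\otimes\mathbb{F}^3$ for which the $e_{ij}$ are orthonormal. The \emph{canonical subspaces} of $\mathbb{F}^2\otimes\mathbb{F}^3$ are the following, where $(u,v)$ ranges over all pairs in $\mathbb{F}^2$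 with $v\ne0$ and $v\lambda^2+uv\lambda-1\neq0$ for all $\lambda\in\mathbb{F}$, and $(\alpha,\beta,\gamma)$ over all triples in $\mathbb{F}^3$ with $\lambda^3+\gamma\lambda^2-\beta\lambda+\alpha\ne0$ for all $\lambda\in\mathbb{F}$: - $o_0$: $0$; - $o_1$: $\langle e_{11}\rangle$; $\;o_4$: $\langle e_{11}+e_{22}\rangle$; - $o_2$: $\langle e_{11},e_{12}\rangle$; $\;o_4^T$: $\langle e_{11},e_{21}\rangle$; $\;o_5$: $\langle e_{11},e_{22}\rangle$; $\;o_6$: $\langle e_{11}+e_{22},e_{21}\rangle$; $\;o_7$: $\langle e_{11}+e_{23},e_{12}\rangle$; $\;o_{10}$: $\langle e_{11}+ue_{12}+e_{22},\,e_{12}+ve_{21}\rangle$; $\;o_{11}$: $\langle e_{11}+e_{22},e_{12}+e_{23}\rangle$; - $o_3$: $\langle e_{11},e_{12},e_{13}\rangle$; $\;o_7^T$: $\langle e_{21},e_{22},e_{11}\rangle$; $\;o_8$: $\langle e_{11},e_{22},e_{23}\rangle$; $\;o_9$: $\langle e_{21},e_{22},e_{11}+e_{23}\rangle$; $\;o_{11}^T$: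 $\langle e_{11},e_{12}+e_{21},e_{22}\rangle$; $\;o_{12}$: $\langle e_{11}+e_{23},e_{12},e_{22}\rangle$; $\;o_{13}$: $\langle e_{11}+e_{22},e_{12},e_{23}\rangle$; $\;o_{14}$: $\langle e_{11},e_{12}+e_{22},e_{23}\rangle$; $\;o_{15}$: $\langle e_{11}+ue_{12}+e_{22},\,e_{12}+ve_{21},\,e_{13}\rangle$; $\;o_{16}$: $\langle e_{11}+e_{22},e_{12}+e_{23},e_{13}\rangle$; $\;o_{17}$: $\langle e_{11}+e_{22},\,e_{12}+e_{23},\,e_{13}+\alpha e_{21}+\beta e_{22}+\gamma e_{23}\rangle$; - $o_i^\perp$ for $i=0,1,2,4,5,6,7,10,11$, and $(o_4^T)^\perp$: the orthogonal spaces of the canonical subspaces for $o_i$ and $o_4^T$. An $H$-orbit on $V$ is said to have one of these $31$ names if it contains a tensor whose third contraction space is a canonical subspace with that name. \textbf{Theorem.} Every $H$-orbit on $V$ has one of these names. If $|\mathbb{F}|\neq2$, then every tensor in an $H$-orbit with a given name has the tensor rank listed in the following table: | tensor rank | names | |---|---| | 0 | $o_0$ | | 1 | $o_1$ | | 2 |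 $o_2,\ o_4,\ o_4^T,\ o_5$ | | 3 | $o_3,\ o_6,\ o_7,\ o_7^T,\ o_8,\ o_{10},\ o_{11},\ o_{11}^T,\ o_{14}$ | | 4 | $o_9,\ o_{12},\ o_{13},\ o_{15},\ o_{16},\ o_{17},\ o_2^\perp,\ (o_4^T)^\perp,\ o_5^\perp,\ o_7^\perp,\ o_{11}^\perp$ | | 5 | $o_1^\perp,\ o_4^\perp,\ o_6^\perp,\ o_{10}^\perp$ | | 6 | $o_0^\perp$ | If $|\mathbb{F}|=2$, the same holds with the only exceptions that $o_{17}$ and $o_{11}^\perp$ have tensor rank $5$. -/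

import Mathlib

open scoped TensorProduct

namespace Tensor23r

/-- The tensor product `F^2 ⊗ F^3`. -/
abbrev V23 (F : Type*) [Field F] : Type _ := (Fin 2 → F) ⊗[F] (Fin 3 → F)

/-- The tensor product `F^2 ⊗ F^3 ⊗ F^r`. -/
abbrev V23r (F : Type*) [Field F] (r : ℕ) : Type _ := V23 F ⊗[F] (Fin r → F)

section Tensors

variable {F : Type*} [Field F] {r : ℕ}

/-- Fundamental tensors `a ⊗ b ⊗ c` with `a`, `b`, `c` nonzero. -/
def IsFundamental (A : V23r F r) : Prop :=
  ∃ (a : Fin 2 → F) (b : Fin 3 → F) (c : Fin r → F),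
    a ≠ 0 ∧ b ≠ 0 ∧ c ≠ 0 ∧ A = (a ⊗ₜ[F] b) ⊗ₜ[F] c

/-- `A` lies in the span of `k` fundamental tensors. -/
def InSpanOfFundamental (A : V23r F r) (k : ℕ) : Prop :=
  ∃ α : Fin k → V23r F r, (∀ i, IsFundamental (α i)) ∧
    A ∈ Submodule.span F (Set.range α)

/-- The tensor rank: the least `k` such that `A` lies in the span of `k` fundamental tensors. -/
noncomputable def tensorRank (A : V23r F r) : ℕ :=
  sInf {k : ℕ | InSpanOfFundamental A k}

theorem InSpanOfFundamental.zero : InSpanOfFundamental (0 : V23r F r) 0 :=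
  ⟨fun _ => 0, fun i => i.elim0, Submodule.zero_mem _⟩

theorem InSpanOfFundamental.add {A B : V23r F r} {k l : ℕ}
    (hA : InSpanOfFundamental A k) (hB : InSpanOfFundamental B l) :
    InSpanOfFundamental (A + B) (k + l) := by
  obtain ⟨α, hα, hA⟩ := hA
  obtain ⟨γ, hγ, hB⟩ := hB
  refine ⟨Fin.append α γ, fun i => ?_, Submodule.add_mem _ ?_ ?_⟩
  · refine Fin.addCases (fun i => ?_) (fun i => ?_) i
    · rw [Fin.append_left]; exact hα i
    · rw [Fin.append_right]; exact hγ i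
  · refine Submodule.span_mono ?_ hA
    rintro _ ⟨i, rfl⟩
    exact ⟨Fin.castAdd l i, Fin.append_left _ _ _⟩
  · refine Submodule.span_mono ?_ hB
    rintro _ ⟨i, rfl⟩
    exact ⟨Fin.natAdd k i, Fin.append_right _ _ _⟩

/-- Every tensor lies in the span of finitely many fundamental tensors, so that the infimum in
`tensorRank` is attained. -/
theorem exists_inSpanOfFundamental (A : V23r F r) : ∃ k, InSpanOfFundamental A k := by
  induction A using TensorProduct.induction_on with
  | zero => exact ⟨0, .zero⟩
  | add A B hA hB =>
    obtain ⟨k, hk⟩ := hA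
    obtain ⟨l, hl⟩ := hB
    exact ⟨k + l, hk.add hl⟩
  | tmul x c =>
    induction x using TensorProduct.induction_on with
    | zero => exact ⟨0, by rw [TensorProduct.zero_tmul]; exact .zero⟩
    | add x y hx hy =>
      obtain ⟨k, hk⟩ := hx
      obtain ⟨l, hl⟩ := hy
      exact ⟨k + l, by rw [TensorProduct.add_tmul]; exact hk.add hl⟩
    | tmul a b =>
      by_cases h : a ≠ 0 ∧ b ≠ 0 ∧ c ≠ 0
      · exact ⟨1, fun _ => (a ⊗ₜ[F] b) ⊗ₜ[F] c, fun _ => ⟨a, b, c, h.1, h.2.1, h.2.2, rfl⟩,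
          Submodule.subset_span ⟨0, rfl⟩⟩
      · refine ⟨0, ?_⟩
        have h0 : (a ⊗ₜ[F] b) ⊗ₜ[F] c = (0 : V23r F r) := by
          by_cases ha : a = 0
          · simp [ha]
          by_cases hb : b = 0
          · simp [hb]
          by_cases hc : c = 0
          · simp [hc]
          exact absurd ⟨ha, hb, hc⟩ h
        rw [h0]
        exact .zero

/-- The action of `(g₁, g₂, g₃)` in `H = GL(F^2) × GL(F^3) × GL(F^r)` on `F^2 ⊗ F^3 ⊗ F^r`. -/
noncomputable def hAct (g₁ : (Fin 2 → F) ≃ₗ[F] (Fin 2 → F)) (g₂ : (Fin 3 → F) ≃ₗ[F] (Fin 3 → F))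
    (g₃ : (Fin r → F) ≃ₗ[F] (Fin r → F)) : V23r F r ≃ₗ[F] V23r F r :=
  TensorProduct.congr (TensorProduct.congr g₁ g₂) g₃

/-- The `H`-orbit of a tensor. -/
def hOrbit (A : V23r F r) : Set (V23r F r) :=
  {B | ∃ g₁ g₂ g₃, B = hAct g₁ g₂ g₃ A}

/-- The third contraction space of `A`, spanned by the contractions `w(A)` for `w` in the dual of
`F^r`, where `w(a ⊗ b ⊗ c) = w(c) • (a ⊗ b)`. -/
noncomputable def contraction3 (A : V23r F r) : Submodule F (V23 F) :=
  Submodule.span F (Set.range fun w : Module.Dual F (Fin r → F) =>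
    TensorProduct.rid F (V23 F) (LinearMap.lTensor (V23 F) w A))

end Tensors

section Subspaces

variable (F : Type*) [Field F]

/-- The bilinear form on `F^2 ⊗ F^3` with `β (a ⊗ b) (c ⊗ d) = (a · c) (b · d)`. -/
noncomputable def form : LinearMap.BilinForm F (V23 F) :=
  LinearMap.BilinForm.tmul
    (dotProductBilin F F : LinearMap.BilinForm F (Fin 2 → F))
    (dotProductBilin F F : LinearMap.BilinForm F (Fin 3 → F))

/-- The orthogonal space with respect to `form`. -/
noncomputable def perp (U : Submodule F (V23 F)) : Submodule F (V23 F) :=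
  (form F).orthogonal U

/-- The basis tensor `e_i ⊗ e_j` of `F^2 ⊗ F^3`; indices start from `0`. -/
noncomputable def E (i : Fin 2) (j : Fin 3) : V23 F :=
  (Pi.single i (1 : F) : Fin 2 → F) ⊗ₜ[F] (Pi.single j (1 : F) : Fin 3 → F)

/-- The parameters `(u, v)` for which the quadratic form `X^2 - u v X Y - v Y^2` has no nontrivial
zero. -/
def AdmissibleQuadratic (u v : F) : Prop :=
  v ≠ 0 ∧ ∀ t : F, v * t ^ 2 + u * v * t - 1 ≠ 0

/-- The parameters `(a, b, c)` for which the cubic `t^3 + c t^2 - b t + a` has no zero. -/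
def AdmissibleCubic (a b c : F) : Prop :=
  ∀ t : F, t ^ 3 + c * t ^ 2 - b * t + a ≠ 0

/-- The names of the orbits. A final `T` stands for the transpose, a final `p` for `⊥`. -/
inductive OrbitName
  | o0 | o1 | o2 | o3 | o4 | o4T | o5 | o6 | o7 | o7T | o8 | o9 | o10 | o11 | o11T
  | o12 | o13 | o14 | o15 | o16 | o17
  | o0p | o1p | o2p | o4p | o4Tp | o5p | o6p | o7p | o10p | o11p

open Submodule in
/-- The canonical subspaces of `F^2 ⊗ F^3`: one subspace for each name, or a family of them when
the canonical form involves parameters. -/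
noncomputable def canonical : OrbitName → Set (Submodule F (V23 F))
  | .o0 => {⊥}
  | .o1 => {span F {E F 0 0}}
  | .o4 => {span F {E F 0 0 + E F 1 1}}
  | .o2 => {span F {E F 0 0, E F 0 1}}
  | .o4T => {span F {E F 0 0, E F 1 0}}
  | .o5 => {span F {E F 0 0, E F 1 1}}
  | .o6 => {span F {E F 0 0 + E F 1 1, E F 1 0}}
  | .o7 => {span F {E F 0 0 + E F 1 2, E F 0 1}}
  | .o10 => {U | ∃ u v : F, AdmissibleQuadratic F u v ∧
      U = span F {E F 0 0 + u • E F 0 1 + E F 1 1, E F 0 1 + v • E F 1 0}}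
  | .o11 => {span F {E F 0 0 + E F 1 1, E F 0 1 + E F 1 2}}
  | .o3 => {span F {E F 0 0, E F 0 1, E F 0 2}}
  | .o7T => {span F {E F 1 0, E F 1 1, E F 0 0}}
  | .o8 => {span F {E F 0 0, E F 1 1, E F 1 2}}
  | .o9 => {span F {E F 1 0, E F 1 1, E F 0 0 + E F 1 2}}
  | .o11T => {span F {E F 0 0, E F 0 1 + E F 1 0, E F 1 1}}
  | .o12 => {span F {E F 0 0 + E F 1 2, E F 0 1, E F 1 1}}
  | .o13 => {span F {E F 0 0 + E F 1 1, E F 0 1, E F 1 2}}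
  | .o14 => {span F {E F 0 0, E F 0 1 + E F 1 1, E F 1 2}}
  | .o15 => {U | ∃ u v : F, AdmissibleQuadratic F u v ∧
      U = span F {E F 0 0 + u • E F 0 1 + E F 1 1, E F 0 1 + v • E F 1 0, E F 0 2}}
  | .o16 => {span F {E F 0 0 + E F 1 1, E F 0 1 + E F 1 2, E F 0 2}}
  | .o17 => {U | ∃ a b c : F, AdmissibleCubic F a b c ∧
      U = span F {E F 0 0 + E F 1 1, E F 0 1 + E F 1 2,
        E F 0 2 + a • E F 1 0 + b • E F 1 1 + c • E F 1 2}}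
  | .o0p => {perp F ⊥}
  | .o1p => {perp F (span F {E F 0 0})}
  | .o4p => {perp F (span F {E F 0 0 + E F 1 1})}
  | .o2p => {perp F (span F {E F 0 0, E F 0 1})}
  | .o4Tp => {perp F (span F {E F 0 0, E F 1 0})}
  | .o5p => {perp F (span F {E F 0 0, E F 1 1})}
  | .o6p => {perp F (span F {E F 0 0 + E F 1 1, E F 1 0})}
  | .o7p => {perp F (span F {E F 0 0 + E F 1 2, E F 0 1})}
  | .o10p => {U | ∃ u v : F, AdmissibleQuadratic F u v ∧
      U = perp F (span F {E F 0 0 + u • E F 0 1 + E F 1 1, E F 0 1 + v • E F 1 0})}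
  | .o11p => {perp F (span F {E F 0 0 + E F 1 1, E F 0 1 + E F 1 2})}

end Subspaces

/-- The set of `H`-orbits in `F^2 ⊗ F^3 ⊗ F^r` that carry the name `X`: the `H`-orbits of the
tensors whose third contraction space is a canonical subspace with that name. -/
def orbitsNamed (F : Type*) [Field F] (r : ℕ) (X : OrbitName) : Set (Set (V23r F r)) :=
  {O | ∃ B : V23r F r, contraction3 B ∈ canonical F X ∧ O = hOrbit B}

/-- The table of tensor ranks. -/
def tableRank : OrbitName → ℕ
  | .o0 => 0
  | .o1 => 1
  | .o2 | .o4 | .o4T | .o5 => 2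
  | .o3 | .o6 | .o7 | .o7T | .o8 | .o10 | .o11 | .o11T | .o14 => 3
  | .o9 | .o12 | .o13 | .o15 | .o16 | .o17 | .o2p | .o4Tp | .o5p | .o7p | .o11p => 4
  | .o1p | .o4p | .o6p | .o10p => 5
  | .o0p => 6

/-- The table of tensor ranks over the field with two elements. -/
def tableRankTwo : OrbitName → ℕ
  | .o17 | .o11p => 5
  | X => tableRank X

end Tensor23r

/-! The theorem is a statement about spaces of 2×3 matrices. Contracting a decomposition of a tensor
into `k` fundamental tensors puts its third contraction space in the span of `k` matrices `a ⊗ b`,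
and conversely, expanding the contractions in such matrices rebuilds a decomposition
(`inSpanOfFundamental_iff`). Since `H` acts on contraction spaces through `GL(F^2) × GL(F^3)`
(`contraction3_hAct`), it remains to classify the subspaces `U` of `F^2 ⊗ F^3` up to this group and
to find, for each canonical one, the least number of rank-one matrices whose span contains it.

Classification (`exists_isNamed`). The contragredient action makes `⊥` compatible with equivalence,
so dimensions above three reduce to dimensions at most two. A plane either contains a rank-one
matrix, or its two row projections share a vector, which gives `o10` or `o11`. In dimension three,
take three points of the projective line of row vectors, which exist over every field. If each
carries a rank-one matrix of `U`, normal forms are immediate; otherwise `U` is the graph `{f₁ ⊗ v +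
f₂ ⊗ T v}` of an endomorphism `T` of `F^3`. Without eigenvectors `T` is a companion matrix (`o17`);
with one, a change of `f₁` turns it into a kernel vector and the Jordan type of `T` decides.

Ranks. The rank is at least `dim U`, and strictly larger when some functional that is nonzero on `U`
kills every rank-one element of `U` (`Spanned.finrank_lt`). Explicit decompositions meet these
bounds, except for `o17` and `o11p` over two elements. The rank-one matrices of `o11p` form a
twisted cubic, so a basis of this 4-space needs four points of the projective line, while `F_2` has
only three. If `o17` had rank 4 over `F_2`, it would lie in a 4-space `D` of rank 4; but `perp F D`
contains no rank-one matrix, so `D` is of type `o10p` or `o11p`, and both have rank 5. -/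

open scoped TensorProduct

namespace Tensor23r

/-! ### Matrix coordinates and the bilinear form -/

section Coordinates

variable {F : Type*} [Field F]

/-- The `(i, j)` entry of an element of `F^2 ⊗ F^3`, seen as a matrix. -/
noncomputable def entry (i : Fin 2) (j : Fin 3) : V23 F →ₗ[F] F :=
  (TensorProduct.lid F F).toLinearMap ∘ₗ
    TensorProduct.map (LinearMap.proj (R := F) (φ := fun _ : Fin 2 => F) i)
      (LinearMap.proj (R := F) (φ := fun _ : Fin 3 => F) j)

@[simp]
theorem entry_tmul (i : Fin 2) (j : Fin 3) (a : Fin 2 → F) (b : Fin 3 → F) :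
    entry i j (a ⊗ₜ[F] b) = a i * b j := by
  simp [entry]

@[simp]
theorem entry_E (i i' : Fin 2) (j j' : Fin 3) :
    entry i j (E F i' j') = if i = i' ∧ j = j' then 1 else 0 := by
  simp only [E, entry_tmul, Pi.single_apply]
  split_ifs <;> simp_all

theorem sum_entry_smul_E (M : V23 F) : ∑ i, ∑ j, entry i j M • E F i j = M := by
  induction M using TensorProduct.induction_on with
  | zero => simp
  | add x y hx hy =>
    simp only [map_add, add_smul, Finset.sum_add_distrib]
    rw [hx, hy]
  | tmul a b =>
    have ha : a = ∑ i, a i • (Pi.single i (1 : F) : Fin 2 → F) := by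
      simpa using (pi_eq_sum_univ' a)
    have hb : b = ∑ j, b j • (Pi.single j (1 : F) : Fin 3 → F) := by
      simpa using (pi_eq_sum_univ' b)
    conv_rhs => rw [ha, hb]
    simp only [entry_tmul, E, TensorProduct.sum_tmul, TensorProduct.tmul_sum,
      TensorProduct.smul_tmul_smul]
    exact Finset.sum_comm

theorem ext_entry {M N : V23 F} (h : ∀ i j, entry i j M = entry i j N) : M = N := by
  rw [← sum_entry_smul_E M, ← sum_entry_smul_E N]
  simp only [h]

theorem finrank_V23 : Module.finrank F (V23 F) = 6 := by
  simp

theorem form_apply (M N : V23 F) : form F M N = ∑ i, ∑ j, entry i j M * entry i j N := by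
  induction M using TensorProduct.induction_on with
  | zero => simp
  | add x y hx hy => simp [hx, hy, add_mul, Finset.sum_add_distrib]
  | tmul a b =>
    induction N using TensorProduct.induction_on with
    | zero => simp
    | add x y hx hy =>
      simp only [map_add, hx, hy, mul_add, Finset.sum_add_distrib]
    | tmul c d =>
      simp [form, dotProduct, Fin.sum_univ_succ]
      ring

theorem form_isSymm : (form F).IsSymm := ⟨fun M N => by
  simp only [form_apply, mul_comm]⟩

theorem form_nondegenerate : (form F).Nondegenerate := by
  have key : ∀ M : V23 F, (∀ N, form F M N = 0) → M = 0 := fun M h => by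
    refine ext_entry fun i j => ?_
    have := h (E F i j)
    rw [form_apply] at this
    fin_cases i <;> fin_cases j <;> simpa [Fin.sum_univ_succ] using this
  refine ⟨key, fun M h => key M fun N => ?_⟩
  rw [← h N]
  simp only [form_apply, mul_comm]

theorem mem_perp_iff {U : Submodule F (V23 F)} {M : V23 F} :
    M ∈ perp F U ↔ ∀ N ∈ U, form F N M = 0 := Iff.rfl

theorem mem_perp_span_iff {S : Set (V23 F)} {M : V23 F} :
    M ∈ perp F (Submodule.span F S) ↔ ∀ N ∈ S, form F N M = 0 := by
  refine ⟨fun h N hN => h N (Submodule.subset_span hN), fun h N hN => ?_⟩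
  change N ∈ LinearMap.ker ((form F).flip M)
  exact Submodule.span_le.2 (fun N hN => h N hN) hN

theorem finrank_perp (U : Submodule F (V23 F)) :
    Module.finrank F (perp F U) = 6 - Module.finrank F U := by
  rw [perp, LinearMap.BilinForm.finrank_orthogonal form_nondegenerate, finrank_V23]

theorem perp_perp (U : Submodule F (V23 F)) : perp F (perp F U) = U :=
  LinearMap.BilinForm.orthogonal_orthogonal form_nondegenerate form_isSymm.isRefl U

theorem perp_anti {U W : Submodule F (V23 F)} (h : U ≤ W) : perp F W ≤ perp F U :=
  fun _ hM N hN => hM N (h hN)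

end Coordinates

/-! ### Rank of a subspace, and its invariance under equivalence -/

section Spanned

variable {F : Type*} [Field F]

/-- `U` is contained in the span of `k` tensors of the form `a ⊗ b`. -/
def Spanned (U : Submodule F (V23 F)) (k : ℕ) : Prop :=
  ∃ (a : Fin k → Fin 2 → F) (b : Fin k → Fin 3 → F),
    U ≤ Submodule.span F (Set.range fun i => a i ⊗ₜ[F] b i)

/-- `k` is the least number of tensors `a ⊗ b` whose span contains `U`. -/
def HasRank (U : Submodule F (V23 F)) (k : ℕ) : Prop :=
  Spanned U k ∧ ∀ l, Spanned U l → k ≤ l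

theorem Spanned.finrank_le {U : Submodule F (V23 F)} {k : ℕ} (h : Spanned U k) :
    Module.finrank F U ≤ k := by
  obtain ⟨a, b, h⟩ := h
  refine (Submodule.finrank_mono h).trans ((finrank_range_le_card _).trans ?_)
  simp

/-- If `dim U` rank-one tensors sufficed, they would form a basis of `U`; lying in `U`, they would
be killed by `l`, and so would all of `U`. This gives every lower bound that exceeds the dimension
by one. -/
theorem Spanned.finrank_lt {U : Submodule F (V23 F)} {k : ℕ} (h : Spanned U k)
    (l : V23 F →ₗ[F] F) (hl : ∃ M ∈ U, l M ≠ 0)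
    (hp : ∀ a b, a ⊗ₜ[F] b ∈ U → l (a ⊗ₜ[F] b) = 0) : Module.finrank F U < k := by
  refine lt_of_le_of_ne h.finrank_le fun hk => ?_
  obtain ⟨a, b, h⟩ := h
  have hU : U = Submodule.span F (Set.range fun i => a i ⊗ₜ[F] b i) := by
    refine Submodule.eq_of_le_of_finrank_le h ?_
    rw [hk]
    exact (finrank_range_le_card _).trans (by simp)
  obtain ⟨M, hM, hlM⟩ := hl
  refine hlM ?_
  rw [hU] at hM
  change M ∈ LinearMap.ker l
  refine Submodule.span_le.2 ?_ hM
  rintro _ ⟨i, rfl⟩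
  refine hp _ _ ?_
  rw [hU]
  exact Submodule.subset_span ⟨i, rfl⟩

theorem spanned_of_sum {U : Submodule F (V23 F)} {k : ℕ} (a : Fin k → Fin 2 → F)
    (b : Fin k → Fin 3 → F)
    (h : ∀ M ∈ U, ∃ c : Fin k → F, ∀ i j, entry i j M = ∑ l, c l * (a l i * b l j)) :
    Spanned U k := by
  refine ⟨a, b, fun M hM => ?_⟩
  obtain ⟨c, hc⟩ := h M hM
  rw [Submodule.mem_span_range_iff_exists_fun]
  exact ⟨c, ext_entry fun i j => by simp [hc]⟩

theorem hasRank_of_finrank {U : Submodule F (V23 F)} {k : ℕ} (hk : Module.finrank F U = k)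
    (h : Spanned U k) : HasRank U k :=
  ⟨h, fun _ hl => hk ▸ hl.finrank_le⟩

theorem hasRank_of_finrank_succ {U : Submodule F (V23 F)} {k : ℕ}
    (hk : Module.finrank F U = k) (h : Spanned U (k + 1)) (l : V23 F →ₗ[F] F)
    (hl : ∃ M ∈ U, l M ≠ 0) (hp : ∀ a b, a ⊗ₜ[F] b ∈ U → l (a ⊗ₜ[F] b) = 0) :
    HasRank U (k + 1) :=
  ⟨h, fun _ hs => hk ▸ hs.finrank_lt l hl hp⟩

/-- Two subspaces of `F^2 ⊗ F^3` in the same orbit of `GL(F^2) × GL(F^3)`. -/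
def Equivalent (U C : Submodule F (V23 F)) : Prop :=
  ∃ (g₁ : (Fin 2 → F) ≃ₗ[F] (Fin 2 → F)) (g₂ : (Fin 3 → F) ≃ₗ[F] (Fin 3 → F)),
    U.map (TensorProduct.congr g₁ g₂).toLinearMap = C

theorem Equivalent.symm {U C : Submodule F (V23 F)} (h : Equivalent U C) : Equivalent C U := by
  obtain ⟨g₁, g₂, rfl⟩ := h
  refine ⟨g₁.symm, g₂.symm, ?_⟩
  rw [← Submodule.map_comp]
  have hid : (TensorProduct.congr g₁.symm g₂.symm).toLinearMap ∘ₗ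
      (TensorProduct.congr g₁ g₂).toLinearMap = LinearMap.id :=
    TensorProduct.ext' fun a b => by simp
  exact (congrArg (fun f => U.map f) hid).trans (Submodule.map_id U)

theorem Equivalent.spanned {U C : Submodule F (V23 F)} {k : ℕ} (h : Equivalent U C)
    (hC : Spanned U k) : Spanned C k := by
  obtain ⟨g₁, g₂, rfl⟩ := h
  obtain ⟨a, b, hab⟩ := hC
  refine ⟨fun i => g₁ (a i), fun i => g₂ (b i), (Submodule.map_mono hab).trans ?_⟩
  rw [Submodule.map_span, ← Set.range_comp]
  exact le_of_eq (by congr 2)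

theorem Equivalent.hasRank {U C : Submodule F (V23 F)} {k : ℕ} (h : Equivalent U C)
    (hC : HasRank U k) : HasRank C k :=
  ⟨h.spanned hC.1, fun l hl => hC.2 l (h.symm.spanned hl)⟩

theorem Equivalent.finrank_eq {U C : Submodule F (V23 F)} (h : Equivalent U C) :
    Module.finrank F U = Module.finrank F C := by
  obtain ⟨g₁, g₂, rfl⟩ := h
  exact (LinearEquiv.finrank_map_eq (TensorProduct.congr g₁ g₂) U).symm

/-- The inverse transpose. It makes orthogonal complements follow the action in `Equivalent.perp`.
-/
theorem exists_contragredient {n : ℕ} (g : (Fin n → F) ≃ₗ[F] (Fin n → F)) :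
    ∃ g' : (Fin n → F) ≃ₗ[F] (Fin n → F), ∀ x y, g x ⬝ᵥ g' y = x ⬝ᵥ y := by
  set A := LinearMap.toMatrix' g.toLinearMap with hA
  set B := LinearMap.toMatrix' g.symm.toLinearMap with hB
  have hAB : A * B = 1 := by
    rw [hA, hB, ← LinearMap.toMatrix'_comp]; simp
  have hBA : B * A = 1 := by
    rw [hA, hB, ← LinearMap.toMatrix'_comp]; simp
  refine ⟨Matrix.toLin'OfInv (M := A.transpose) (M' := B.transpose) ?_ ?_, fun x y => ?_⟩
  · rw [← Matrix.transpose_mul, hBA, Matrix.transpose_one]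
  · rw [← Matrix.transpose_mul, hAB, Matrix.transpose_one]
  · have hg : g x = A.mulVec x := by rw [hA, LinearMap.toMatrix'_mulVec]; rfl
    rw [hg]
    change A.mulVec x ⬝ᵥ B.transpose.mulVec y = _
    rw [Matrix.dotProduct_mulVec, Matrix.vecMul_transpose, Matrix.mulVec_mulVec, hBA,
      Matrix.one_mulVec]

theorem Equivalent.perp {U C : Submodule F (V23 F)} (h : Equivalent U C) :
    Equivalent (perp F U) (perp F C) := by
  obtain ⟨g₁, g₂, hC⟩ := h
  obtain ⟨g₁', h₁⟩ := exists_contragredient g₁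
  obtain ⟨g₂', h₂⟩ := exists_contragredient g₂
  have hform : ∀ M N, form F (TensorProduct.congr g₁ g₂ M) (TensorProduct.congr g₁' g₂' N) =
      form F M N := by
    intro M N
    induction M using TensorProduct.induction_on with
    | zero => simp
    | add x y hx hy => simp only [map_add, LinearMap.add_apply, hx, hy]
    | tmul a b =>
      induction N using TensorProduct.induction_on with
      | zero => simp
      | add x y hx hy => simp only [map_add, hx, hy]
      | tmul c d => simp [form, h₁, h₂]
  refine ⟨g₁', g₂', ?_⟩
  refine Submodule.eq_of_le_of_finrank_eq ?_ ?_
  · rintro _ ⟨N, hN, rfl⟩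
    rw [mem_perp_iff, ← hC]
    rintro _ ⟨M, hM, rfl⟩
    exact (hform M N).trans (hN M hM)
  · have := (LinearEquiv.finrank_map_eq (TensorProduct.congr g₁' g₂') (Tensor23r.perp F U))
    rw [this, finrank_perp, finrank_perp, Equivalent.finrank_eq ⟨g₁, g₂, hC⟩]

end Spanned

/-! ### From tensors to contraction spaces -/

section Contraction

variable {F : Type*} [Field F] {r : ℕ}

theorem contraction3_hAct (g₁ : (Fin 2 → F) ≃ₗ[F] (Fin 2 → F))
    (g₂ : (Fin 3 → F) ≃ₗ[F] (Fin 3 → F)) (g₃ : (Fin r → F) ≃ₗ[F] (Fin r → F)) (A : V23r F r) :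
    contraction3 (hAct g₁ g₂ g₃ A) =
      (contraction3 A).map (TensorProduct.congr g₁ g₂).toLinearMap := by
  have key : ∀ w : Module.Dual F (Fin r → F),
      TensorProduct.rid F (V23 F) (LinearMap.lTensor (V23 F) w (hAct g₁ g₂ g₃ A)) =
      TensorProduct.congr g₁ g₂ (TensorProduct.rid F (V23 F)
        (LinearMap.lTensor (V23 F) (w ∘ₗ g₃.toLinearMap) A)) := by
    intro w
    induction A using TensorProduct.induction_on with
    | zero => simp only [LinearMap.map_zero, LinearEquiv.map_zero]
    | add x y hx hy => simp only [LinearMap.map_add, LinearEquiv.map_add, hx, hy]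
    | tmul x c => simp [hAct]
  rw [contraction3, contraction3, Submodule.map_span, ← Set.range_comp]
  refine le_antisymm (Submodule.span_mono ?_) (Submodule.span_mono ?_)
  · rintro _ ⟨w, rfl⟩
    exact ⟨w ∘ₗ g₃.toLinearMap, (key w).symm⟩
  · rintro _ ⟨w, rfl⟩
    refine ⟨w ∘ₗ g₃.symm.toLinearMap, (key _).trans ?_⟩
    have : (w ∘ₗ g₃.symm.toLinearMap) ∘ₗ g₃.toLinearMap = w := by ext; simp
    rw [this]; rfl

theorem hOrbit_hAct (g₁ : (Fin 2 → F) ≃ₗ[F] (Fin 2 → F))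
    (g₂ : (Fin 3 → F) ≃ₗ[F] (Fin 3 → F)) (g₃ : (Fin r → F) ≃ₗ[F] (Fin r → F)) (A : V23r F r) :
    hOrbit (hAct g₁ g₂ g₃ A) = hOrbit A := by
  have hcomp : ∀ (h₁ k₁ : (Fin 2 → F) ≃ₗ[F] (Fin 2 → F)) (h₂ k₂ : (Fin 3 → F) ≃ₗ[F] (Fin 3 → F))
      (h₃ k₃ : (Fin r → F) ≃ₗ[F] (Fin r → F)),
      hAct h₁ h₂ h₃ (hAct k₁ k₂ k₃ A) = hAct (k₁.trans h₁) (k₂.trans h₂) (k₃.trans h₃) A := by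
    intro h₁ k₁ h₂ k₂ h₃ k₃
    rw [hAct, hAct, hAct, TensorProduct.congr_trans, TensorProduct.congr_trans]
    rfl
  ext B
  constructor
  · rintro ⟨h₁, h₂, h₃, rfl⟩
    exact ⟨_, _, _, hcomp _ _ _ _ _ _⟩
  · rintro ⟨h₁, h₂, h₃, rfl⟩
    refine ⟨g₁.symm.trans h₁, g₂.symm.trans h₂, g₃.symm.trans h₃, ?_⟩
    rw [hcomp]
    congr 2 <;> ext <;> simp

theorem sum_contraction (A : V23r F r) :
    ∑ j, TensorProduct.rid F (V23 F) (LinearMap.lTensor (V23 F) (LinearMap.proj j) A) ⊗ₜ[F]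
      (Pi.single j (1 : F) : Fin r → F) = A := by
  induction A using TensorProduct.induction_on with
  | zero => simp only [LinearMap.map_zero, LinearEquiv.map_zero, TensorProduct.zero_tmul,
      Finset.sum_const_zero]
  | add x y hx hy =>
    simp only [LinearMap.map_add, LinearEquiv.map_add, TensorProduct.add_tmul, Finset.sum_add_distrib]
    rw [hx, hy]
  | tmul x c =>
    have hc : c = ∑ j, c j • (Pi.single j (1 : F) : Fin r → F) := by
      simpa using (pi_eq_sum_univ' c)
    conv_rhs => rw [hc]
    simp [TensorProduct.tmul_sum, TensorProduct.smul_tmul]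

/-- A contraction of `a ⊗ b ⊗ c` is a multiple of `a ⊗ b`. Conversely, expand the coordinate
contractions in the `a i ⊗ b i` and collect, for each `i`, the coefficients into one vector of
`F^r`. -/
theorem inSpanOfFundamental_iff (hr : 1 ≤ r) (A : V23r F r) (k : ℕ) :
    InSpanOfFundamental A k ↔ Spanned (contraction3 A) k := by
  constructor
  · rintro ⟨α, hα, hA⟩
    choose a b c _ _ _ h using hα
    refine ⟨a, b, Submodule.span_le.2 ?_⟩
    rintro _ ⟨w, rfl⟩
    have hmem := Submodule.mem_map_of_mem (f := (TensorProduct.rid F (V23 F)).toLinearMap ∘ₗ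
      LinearMap.lTensor (V23 F) w) hA
    rw [Submodule.map_span, ← Set.range_comp] at hmem
    refine Submodule.span_le.2 ?_ hmem
    rintro _ ⟨i, rfl⟩
    simp only [Function.comp_apply, h, LinearMap.comp_apply, LinearMap.lTensor_tmul,
      LinearEquiv.coe_coe, TensorProduct.rid_tmul]
    exact Submodule.smul_mem _ _ (Submodule.subset_span ⟨i, rfl⟩)
  · rintro ⟨a, b, h⟩
    have hmem : ∀ j : Fin r, ∃ c : Fin k → F, ∑ i, c i • (a i ⊗ₜ[F] b i) =
        TensorProduct.rid F (V23 F) (LinearMap.lTensor (V23 F) (LinearMap.proj j) A) := fun j =>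
      (Submodule.mem_span_range_iff_exists_fun F).1
        (h (Submodule.subset_span ⟨LinearMap.proj j, rfl⟩))
    choose c hc using hmem
    have hA : A = ∑ i, (a i ⊗ₜ[F] b i) ⊗ₜ[F] (fun j => c j i) := by
      conv_lhs => rw [← sum_contraction A]
      simp only [← hc, TensorProduct.sum_tmul]
      rw [Finset.sum_comm]
      refine Finset.sum_congr rfl fun i _ => ?_
      have hc' : (fun j => c j i) = ∑ j, c j i • (Pi.single j (1 : F) : Fin r → F) := by
        simpa using (pi_eq_sum_univ' fun j => c j i)
      rw [hc', TensorProduct.tmul_sum]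
      simp only [TensorProduct.smul_tmul]
    -- Fundamental tensors have nonzero factors, so vanishing summands must be replaced by some
    -- fundamental tensor; one exists because `1 ≤ r`.
    have hex : ∃ B : V23r F r, IsFundamental B := by
      refine ⟨_, fun _ => 1, fun _ => 1, fun _ => 1, ?_, ?_, ?_, rfl⟩
      · exact fun h => one_ne_zero (congrFun h 0)
      · exact fun h => one_ne_zero (congrFun h 0)
      · exact fun h => one_ne_zero (congrFun h ⟨0, hr⟩)
    obtain ⟨B, hB⟩ := hex
    classical
    refine ⟨fun i => if a i ≠ 0 ∧ b i ≠ 0 ∧ (fun j => c j i) ≠ 0 then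
      (a i ⊗ₜ[F] b i) ⊗ₜ[F] (fun j => c j i) else B, fun i => ?_, ?_⟩
    · dsimp only
      split_ifs with hi
      · exact ⟨_, _, _, hi.1, hi.2.1, hi.2.2, rfl⟩
      · exact hB
    · rw [hA]
      refine Submodule.sum_mem _ fun i _ => ?_
      by_cases hi : a i ≠ 0 ∧ b i ≠ 0 ∧ (fun j => c j i) ≠ 0
      · refine Submodule.subset_span ⟨i, ?_⟩
        dsimp only
        rw [if_pos hi]
      · have h0 : (a i ⊗ₜ[F] b i) ⊗ₜ[F] (fun j => c j i) = (0 : V23r F r) := by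
          by_cases ha : a i = 0
          · simp [ha]
          by_cases hb : b i = 0
          · simp [hb]
          by_cases hc : (fun j => c j i) = 0
          · simp [hc]
          exact absurd ⟨ha, hb, hc⟩ hi
        rw [h0]
        exact Submodule.zero_mem _

theorem tensorRank_eq_of_hasRank (hr : 1 ≤ r) {A : V23r F r} {k : ℕ}
    (h : HasRank (contraction3 A) k) : tensorRank A = k := by
  have hset : {k : ℕ | InSpanOfFundamental A k} = {k | Spanned (contraction3 A) k} :=
    Set.ext fun k => inSpanOfFundamental_iff hr A k
  rw [tensorRank, hset]
  exact le_antisymm (Nat.sInf_le h.1) (h.2 _ (Nat.sInf_mem (s := {k | Spanned (contraction3 A) k}) ⟨k, h.1⟩))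

end Contraction

/-! ### Dimensions of the canonical subspaces -/

section SpanRank

variable {F : Type*} [Field F]

theorem spanned_span {S : Set (V23 F)} {k : ℕ} (a : Fin k → Fin 2 → F) (b : Fin k → Fin 3 → F)
    (h : ∀ M ∈ S, ∃ c : Fin k → F, ∀ i j, entry i j M = ∑ l, c l * (a l i * b l j)) :
    Spanned (Submodule.span F S) k := by
  refine ⟨a, b, Submodule.span_le.2 fun M hM => ?_⟩
  obtain ⟨c, hc⟩ := h M hM
  rw [SetLike.mem_coe, Submodule.mem_span_range_iff_exists_fun]
  exact ⟨c, ext_entry fun i j => by simp [hc]⟩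

theorem finrank_span_pair {x y : V23 F}
    (h : ∀ a b : F, (∀ i j, a * entry i j x + b * entry i j y = 0) → a = 0 ∧ b = 0) :
    Module.finrank F (Submodule.span F {x, y}) = 2 := by
  have hli : LinearIndependent F ![x, y] := LinearIndependent.pair_iff.2 fun a b hab =>
    h a b fun i j => by simpa using congrArg (entry i j) hab
  have hr : Set.range ![x, y] = {x, y} := by
    ext w; simp [eq_comm]; tauto
  rw [← hr]
  simpa using finrank_span_eq_card hli

theorem finrank_span_triple {x y z : V23 F}
    (h : ∀ a b c : F, (∀ i j, a * entry i j x + b * entry i j y + c * entry i j z = 0) →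
      a = 0 ∧ b = 0 ∧ c = 0) :
    Module.finrank F (Submodule.span F {x, y, z}) = 3 := by
  have hli : LinearIndependent F ![x, y, z] := by
    rw [Fintype.linearIndependent_iff]
    intro g hg
    have := h (g 0) (g 1) (g 2) fun i j => by
      simpa [Fin.sum_univ_succ, add_assoc] using congrArg (entry i j) hg
    intro i
    fin_cases i
    exacts [this.1, this.2.1, this.2.2]
  have hr : Set.range ![x, y, z] = {x, y, z} := by
    ext w; simp [eq_comm]; tauto
  rw [← hr]
  simpa using finrank_span_eq_card hli

theorem entry_zero_zero_eq_zero_of_pair {x y : V23 F}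
    (h : ∀ p q : F, ∀ (a : Fin 2 → F) (b : Fin 3 → F),
      (∀ i j, p * entry i j x + q * entry i j y = a i * b j) → a 0 * b 0 = 0)
    (a : Fin 2 → F) (b : Fin 3 → F) (hab : a ⊗ₜ[F] b ∈ Submodule.span F {x, y}) :
    entry 0 0 (a ⊗ₜ[F] b) = 0 := by
  obtain ⟨p, q, hpq⟩ := Submodule.mem_span_pair.1 hab
  rw [entry_tmul]
  exact h p q a b fun i j => by simpa using congrArg (entry i j) hpq

theorem entry_zero_zero_eq_zero_of_triple {x y z : V23 F}
    (h : ∀ p q s : F, ∀ (a : Fin 2 → F) (b : Fin 3 → F),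
      (∀ i j, p * entry i j x + q * entry i j y + s * entry i j z = a i * b j) → a 0 * b 0 = 0)
    (a : Fin 2 → F) (b : Fin 3 → F) (hab : a ⊗ₜ[F] b ∈ Submodule.span F {x, y, z}) :
    entry 0 0 (a ⊗ₜ[F] b) = 0 := by
  obtain ⟨p, q, s, hpq⟩ := Submodule.mem_span_triple.1 hab
  rw [entry_tmul]
  exact h p q s a b fun i j => by simpa using congrArg (entry i j) hpq

/-- The dimension of the canonical subspaces with a given name. -/
def nameDim : OrbitName → ℕ
  | .o0 => 0
  | .o1 | .o4 => 1
  | .o2 | .o4T | .o5 | .o6 | .o7 | .o10 | .o11 => 2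
  | .o3 | .o7T | .o8 | .o9 | .o11T | .o12 | .o13 | .o14 | .o15 | .o16 | .o17 => 3
  | .o2p | .o4Tp | .o5p | .o6p | .o7p | .o10p | .o11p => 4
  | .o1p | .o4p => 5
  | .o0p => 6

theorem finrank_canonical {X : OrbitName} {C : Submodule F (V23 F)} (hC : C ∈ canonical F X) :
    Module.finrank F C = nameDim X := by
  cases X
  case o0 => obtain rfl := hC; exact finrank_bot F _
  case o0p =>
    obtain rfl := hC
    rw [finrank_perp, finrank_bot]; rfl
  case o1 =>
    obtain rfl := hC
    refine finrank_span_singleton fun h => ?_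
    simpa using congrArg (entry 0 0) h
  case o4 =>
    obtain rfl := hC
    refine finrank_span_singleton fun h => ?_
    simpa using congrArg (entry 0 0) h
  case o1p =>
    obtain rfl := hC
    rw [finrank_perp, finrank_span_singleton fun h => ?_]; · rfl
    simpa using congrArg (entry 0 0) h
  case o4p =>
    obtain rfl := hC
    rw [finrank_perp, finrank_span_singleton fun h => ?_]; · rfl
    simpa using congrArg (entry 0 0) h
  case o10 | o10p =>
    obtain ⟨u, v, -, rfl⟩ := hC
    try rw [finrank_perp]
    rw [finrank_span_pair]; · rfl
    intro a b h
    simp [Fin.forall_fin_succ] at h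
    grind
  case o15 | o17 =>
    first
    | obtain ⟨u, v, -, rfl⟩ := hC
    | obtain ⟨u, v, w, -, rfl⟩ := hC
    refine finrank_span_triple fun a b c h => ?_
    simp [Fin.forall_fin_succ] at h
    grind
  case o2 | o4T | o5 | o6 | o7 | o11 | o2p | o4Tp | o5p | o6p | o7p | o11p =>
    obtain rfl := hC
    try rw [finrank_perp]
    rw [finrank_span_pair]; · rfl
    intro a b h
    simp [Fin.forall_fin_succ] at h
    grind
  all_goals
    obtain rfl := hC
    refine finrank_span_triple fun a b c h => ?_
    simp [Fin.forall_fin_succ] at h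
    grind

end SpanRank

/-! ### Ranks of the canonical subspaces that do not depend on the field -/

section Rank

variable {F : Type*} [Field F]

theorem hasRank_o0p : HasRank (perp F ⊥) 6 := by
  refine hasRank_of_finrank (by rw [finrank_perp, finrank_bot]) ?_
  refine spanned_of_sum ![![1, 0], ![1, 0], ![1, 0], ![0, 1], ![0, 1], ![0, 1]]
    ![![1, 0, 0], ![0, 1, 0], ![0, 0, 1], ![1, 0, 0], ![0, 1, 0], ![0, 0, 1]] fun M _ =>
    ⟨![entry 0 0 M, entry 0 1 M, entry 0 2 M, entry 1 0 M, entry 1 1 M, entry 1 2 M], ?_⟩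
  simp [Fin.forall_fin_succ, Fin.sum_univ_succ]

theorem spanned_o1p : Spanned (perp F (Submodule.span F {E F 0 0})) 5 := by
  refine spanned_of_sum ![![1, 0], ![1, 0], ![0, 1], ![0, 1], ![0, 1]]
    ![![0, 1, 0], ![0, 0, 1], ![1, 0, 0], ![0, 1, 0], ![0, 0, 1]] fun M hM =>
    ⟨![entry 0 1 M, entry 0 2 M, entry 1 0 M, entry 1 1 M, entry 1 2 M], ?_⟩
  simp only [mem_perp_span_iff, form_apply] at hM
  simp [Fin.sum_univ_succ] at hM
  simp [Fin.forall_fin_succ, Fin.sum_univ_succ, hM]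

theorem spanned_o4p : Spanned (perp F (Submodule.span F {E F 0 0 + E F 1 1})) 5 := by
  refine spanned_of_sum ![![1, 0], ![1, 0], ![0, 1], ![0, 1], ![1, -1]]
    ![![0, 1, 0], ![0, 0, 1], ![1, 0, 0], ![0, 0, 1], ![1, 1, 0]] fun M hM =>
    ⟨![entry 0 1 M - entry 0 0 M, entry 0 2 M, entry 1 0 M + entry 0 0 M, entry 1 2 M,
      entry 0 0 M], ?_⟩
  simp only [mem_perp_span_iff, form_apply] at hM
  simp [Fin.sum_univ_succ] at hM
  simp [Fin.forall_fin_succ, Fin.sum_univ_succ]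
  grind

theorem spanned_o2p : Spanned (perp F (Submodule.span F {E F 0 0, E F 0 1})) 4 := by
  refine spanned_of_sum ![![1, 0], ![0, 1], ![0, 1], ![0, 1]]
    ![![0, 0, 1], ![1, 0, 0], ![0, 1, 0], ![0, 0, 1]] fun M hM =>
    ⟨![entry 0 2 M, entry 1 0 M, entry 1 1 M, entry 1 2 M], ?_⟩
  simp only [mem_perp_span_iff, form_apply] at hM
  simp [Fin.sum_univ_succ] at hM
  simp [Fin.forall_fin_succ, Fin.sum_univ_succ, hM]

theorem spanned_o4Tp : Spanned (perp F (Submodule.span F {E F 0 0, E F 1 0})) 4 := by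
  refine spanned_of_sum ![![1, 0], ![1, 0], ![0, 1], ![0, 1]]
    ![![0, 1, 0], ![0, 0, 1], ![0, 1, 0], ![0, 0, 1]] fun M hM =>
    ⟨![entry 0 1 M, entry 0 2 M, entry 1 1 M, entry 1 2 M], ?_⟩
  simp only [mem_perp_span_iff, form_apply] at hM
  simp [Fin.sum_univ_succ] at hM
  simp [Fin.forall_fin_succ, Fin.sum_univ_succ, hM]

theorem spanned_o5p : Spanned (perp F (Submodule.span F {E F 0 0, E F 1 1})) 4 := by
  refine spanned_of_sum ![![1, 0], ![1, 0], ![0, 1], ![0, 1]]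
    ![![0, 1, 0], ![0, 0, 1], ![1, 0, 0], ![0, 0, 1]] fun M hM =>
    ⟨![entry 0 1 M, entry 0 2 M, entry 1 0 M, entry 1 2 M], ?_⟩
  simp only [mem_perp_span_iff, form_apply] at hM
  simp [Fin.sum_univ_succ] at hM
  simp [Fin.forall_fin_succ, Fin.sum_univ_succ, hM]

theorem spanned_o7p : Spanned (perp F (Submodule.span F {E F 0 0 + E F 1 2, E F 0 1})) 4 := by
  refine spanned_of_sum ![![1, 0], ![0, 1], ![0, 1], ![1, 1]]
    ![![0, 0, 1], ![1, 0, 0], ![0, 1, 0], ![1, 0, -1]] fun M hM =>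
    ⟨![entry 0 2 M + entry 0 0 M, entry 1 0 M - entry 0 0 M, entry 1 1 M, entry 0 0 M], ?_⟩
  simp only [mem_perp_span_iff, form_apply] at hM
  simp [Fin.sum_univ_succ] at hM
  simp [Fin.forall_fin_succ, Fin.sum_univ_succ]
  grind

theorem hasRank_o6p : HasRank (perp F (Submodule.span F {E F 0 0 + E F 1 1, E F 1 0})) 5 := by
  refine hasRank_of_finrank_succ (finrank_canonical (X := .o6p) rfl) ?_ (entry 0 0)
    ⟨E F 0 0 - E F 1 1, ?_, by simp⟩ ?_
  · refine spanned_of_sum ![![1, 0], ![1, 0], ![1, 0], ![0, 1], ![0, 1]]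
      ![![1, 0, 0], ![0, 1, 0], ![0, 0, 1], ![0, 1, 0], ![0, 0, 1]] fun M hM =>
      ⟨![entry 0 0 M, entry 0 1 M, entry 0 2 M, entry 1 1 M, entry 1 2 M], ?_⟩
    simp only [mem_perp_span_iff, form_apply] at hM
    simp [Fin.sum_univ_succ] at hM
    simp [Fin.forall_fin_succ, Fin.sum_univ_succ, hM]
  · simp only [mem_perp_span_iff, form_apply]
    simp [Fin.sum_univ_succ]
  · intro a b h
    simp only [mem_perp_span_iff, form_apply] at h
    simp [Fin.sum_univ_succ] at h
    simp only [entry_tmul]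
    grind

/-- If `a ⊗ b` lies in this space and `a 0 * b 0 ≠ 0`, the second equation gives `b 1 = -v t b 0`
with `t = a 1 / a 0`, and the first then makes `t` a root of the excluded quadratic. -/
theorem hasRank_o10p {u v : F} (huv : AdmissibleQuadratic F u v) :
    HasRank (perp F (Submodule.span F
      {E F 0 0 + u • E F 0 1 + E F 1 1, E F 0 1 + v • E F 1 0})) 5 := by
  refine hasRank_of_finrank_succ (finrank_canonical (X := .o10p) ⟨u, v, huv, rfl⟩) ?_ (entry 0 0)
    ⟨E F 0 0 - E F 1 1, ?_, by simp⟩ ?_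
  · refine spanned_of_sum ![![1, 0], ![0, 1], ![1, 1], ![1, 0], ![0, 1]]
      ![![1, 0, 0], ![0, 1, 0], ![1, -v, 0], ![0, 0, 1], ![0, 0, 1]] fun M hM =>
      ⟨![entry 0 0 M - entry 1 0 M, entry 1 1 M + v * entry 1 0 M, entry 1 0 M, entry 0 2 M,
        entry 1 2 M], ?_⟩
    simp only [mem_perp_span_iff, form_apply] at hM
    simp [Fin.sum_univ_succ] at hM
    simp [Fin.forall_fin_succ, Fin.sum_univ_succ]
    grind
  · simp only [mem_perp_span_iff, form_apply]
    simp [Fin.sum_univ_succ]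
  · intro a b h
    simp only [mem_perp_span_iff, form_apply] at h
    simp [Fin.sum_univ_succ] at h
    simp only [entry_tmul]
    by_contra hab
    obtain ⟨ha, hb⟩ := mul_ne_zero_iff.1 hab
    refine huv.2 (a 1 / a 0) ?_
    field_simp
    grind

theorem spanned_o10 (u v : F) : Spanned (Submodule.span F
    {E F 0 0 + u • E F 0 1 + E F 1 1, E F 0 1 + v • E F 1 0}) 3 := by
  refine spanned_span ![![1, 1], ![1, 0], ![0, 1]] ![![1, 1, 0], ![0, 1, 0], ![1, 0, 0]] ?_
  rintro M (rfl | rfl)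
  · refine ⟨![1, u - 1, -1], ?_⟩
    simp [Fin.forall_fin_succ, Fin.sum_univ_succ]
  · refine ⟨![0, 1, v], ?_⟩
    simp [Fin.forall_fin_succ, Fin.sum_univ_succ]

theorem hasRank_o10 {u v : F} (huv : AdmissibleQuadratic F u v) : HasRank (Submodule.span F
    {E F 0 0 + u • E F 0 1 + E F 1 1, E F 0 1 + v • E F 1 0}) 3 := by
  refine hasRank_of_finrank_succ (finrank_canonical (X := .o10) ⟨u, v, huv, rfl⟩)
    (spanned_o10 u v) (entry 0 0) ⟨_, Submodule.subset_span (Or.inl rfl), by simp⟩ ?_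
  refine entry_zero_zero_eq_zero_of_pair fun p q a b h => ?_
  simp [Fin.forall_fin_succ] at h
  by_contra hab
  have hp : p ≠ 0 := by grind
  -- A rank-one combination has determinant `p ^ 2 - u v p q - v q ^ 2 = 0`; dividing by `-p ^ 2`
  -- gives the quadratic at `q / p`.
  refine huv.2 (q / p) ?_
  field_simp
  grind

theorem hasRank_o15 {u v : F} (huv : AdmissibleQuadratic F u v) : HasRank (Submodule.span F
    {E F 0 0 + u • E F 0 1 + E F 1 1, E F 0 1 + v • E F 1 0, E F 0 2}) 4 := by
  refine hasRank_of_finrank_succ (finrank_canonical (X := .o15) ⟨u, v, huv, rfl⟩)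
    ?_ (entry 0 0) ⟨_, Submodule.subset_span (Or.inl rfl), by simp⟩ ?_
  · refine spanned_span ![![1, 1], ![1, 0], ![0, 1], ![1, 0]]
      ![![1, 1, 0], ![0, 1, 0], ![1, 0, 0], ![0, 0, 1]] ?_
    rintro M (rfl | rfl | rfl)
    · refine ⟨![1, u - 1, -1, 0], ?_⟩
      simp [Fin.forall_fin_succ, Fin.sum_univ_succ]
    · refine ⟨![0, 1, v, 0], ?_⟩
      simp [Fin.forall_fin_succ, Fin.sum_univ_succ]
    · refine ⟨![0, 0, 0, 1], ?_⟩
      simp [Fin.forall_fin_succ, Fin.sum_univ_succ]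
  · refine entry_zero_zero_eq_zero_of_triple fun p q s a b h => ?_
    simp [Fin.forall_fin_succ] at h
    by_contra hab
    have hp : p ≠ 0 := by grind
    -- The minor on the first two columns is the same determinant as for `o10`; the third generator
    -- does not enter it.
    refine huv.2 (q / p) ?_
    field_simp
    grind

theorem spanned_o11 :
    Spanned (Submodule.span F {E F 0 0 + E F 1 1, E F 0 1 + E F 1 2}) 3 := by
  refine spanned_span ![![1, 0], ![1, 1], ![0, 1]] ![![1, -1, 0], ![0, 1, 0], ![0, -1, 1]] ?_
  rintro M (rfl | rfl)
  · refine ⟨![1, 1, 0], ?_⟩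
    simp [Fin.forall_fin_succ, Fin.sum_univ_succ]
  · refine ⟨![0, 1, 1], ?_⟩
    simp [Fin.forall_fin_succ, Fin.sum_univ_succ]

theorem spanned_o16 :
    Spanned (Submodule.span F {E F 0 0 + E F 1 1, E F 0 1 + E F 1 2, E F 0 2}) 4 := by
  refine spanned_span ![![1, 0], ![1, 1], ![0, 1], ![1, 0]]
    ![![1, -1, 0], ![0, 1, 0], ![0, -1, 1], ![0, 0, 1]] ?_
  rintro M (rfl | rfl | rfl)
  · refine ⟨![1, 1, 0, 0], ?_⟩
    simp [Fin.forall_fin_succ, Fin.sum_univ_succ]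
  · refine ⟨![0, 1, 1, 0], ?_⟩
    simp [Fin.forall_fin_succ, Fin.sum_univ_succ]
  · refine ⟨![0, 0, 0, 1], ?_⟩
    simp [Fin.forall_fin_succ, Fin.sum_univ_succ]

theorem hasRank_o1 : HasRank (Submodule.span F {E F 0 0}) 1 := by
  refine hasRank_of_finrank (finrank_canonical (X := .o1) rfl) (spanned_span ![![1, 0]] ![![1, 0, 0]] ?_)
  rintro M rfl
  exact ⟨1, by simp [Fin.forall_fin_succ]⟩

theorem hasRank_o4 : HasRank (Submodule.span F {E F 0 0 + E F 1 1}) 2 := by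
  refine hasRank_of_finrank_succ (finrank_canonical (X := .o4) rfl)
    (spanned_span ![![1, 0], ![0, 1]] ![![1, 0, 0], ![0, 1, 0]] ?_) (entry 0 0)
    ⟨_, Submodule.subset_span rfl, by simp⟩ fun a b h => ?_
  · rintro M rfl
    exact ⟨1, by simp [Fin.forall_fin_succ]⟩
  · obtain ⟨c, hc⟩ := Submodule.mem_span_singleton.1 h
    replace hc := fun i j => congrArg (entry i j) hc
    clear h
    simp [Fin.forall_fin_succ] at hc
    simp only [entry_tmul]
    grind

theorem hasRank_o2 : HasRank (Submodule.span F {E F 0 0, E F 0 1}) 2 := by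
  refine hasRank_of_finrank (finrank_canonical (X := .o2) rfl)
    (spanned_span ![![1, 0], ![1, 0]] ![![1, 0, 0], ![0, 1, 0]] ?_)
  rintro M (rfl | rfl)
  · exact ⟨![1, 0], by simp [Fin.forall_fin_succ]⟩
  · exact ⟨![0, 1], by simp [Fin.forall_fin_succ]⟩

theorem hasRank_o4T : HasRank (Submodule.span F {E F 0 0, E F 1 0}) 2 := by
  refine hasRank_of_finrank (finrank_canonical (X := .o4T) rfl)
    (spanned_span ![![1, 0], ![0, 1]] ![![1, 0, 0], ![1, 0, 0]] ?_)
  rintro M (rfl | rfl)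
  · exact ⟨![1, 0], by simp [Fin.forall_fin_succ]⟩
  · exact ⟨![0, 1], by simp [Fin.forall_fin_succ]⟩

theorem hasRank_o5 : HasRank (Submodule.span F {E F 0 0, E F 1 1}) 2 := by
  refine hasRank_of_finrank (finrank_canonical (X := .o5) rfl)
    (spanned_span ![![1, 0], ![0, 1]] ![![1, 0, 0], ![0, 1, 0]] ?_)
  rintro M (rfl | rfl)
  · exact ⟨![1, 0], by simp [Fin.forall_fin_succ]⟩
  · exact ⟨![0, 1], by simp [Fin.forall_fin_succ]⟩

theorem hasRank_o3 : HasRank (Submodule.span F {E F 0 0, E F 0 1, E F 0 2}) 3 := by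
  refine hasRank_of_finrank (finrank_canonical (X := .o3) rfl)
    (spanned_span ![![1, 0], ![1, 0], ![1, 0]] ![![1, 0, 0], ![0, 1, 0], ![0, 0, 1]] ?_)
  rintro M (rfl | rfl | rfl)
  · exact ⟨![1, 0, 0], by simp [Fin.forall_fin_succ, Fin.sum_univ_succ]⟩
  · exact ⟨![0, 1, 0], by simp [Fin.forall_fin_succ, Fin.sum_univ_succ]⟩
  · exact ⟨![0, 0, 1], by simp [Fin.forall_fin_succ, Fin.sum_univ_succ]⟩

theorem hasRank_o7T : HasRank (Submodule.span F {E F 1 0, E F 1 1, E F 0 0}) 3 := by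
  refine hasRank_of_finrank (finrank_canonical (X := .o7T) rfl)
    (spanned_span ![![0, 1], ![0, 1], ![1, 0]] ![![1, 0, 0], ![0, 1, 0], ![1, 0, 0]] ?_)
  rintro M (rfl | rfl | rfl)
  · exact ⟨![1, 0, 0], by simp [Fin.forall_fin_succ, Fin.sum_univ_succ]⟩
  · exact ⟨![0, 1, 0], by simp [Fin.forall_fin_succ, Fin.sum_univ_succ]⟩
  · exact ⟨![0, 0, 1], by simp [Fin.forall_fin_succ, Fin.sum_univ_succ]⟩

theorem hasRank_o8 : HasRank (Submodule.span F {E F 0 0, E F 1 1, E F 1 2}) 3 := by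
  refine hasRank_of_finrank (finrank_canonical (X := .o8) rfl)
    (spanned_span ![![1, 0], ![0, 1], ![0, 1]] ![![1, 0, 0], ![0, 1, 0], ![0, 0, 1]] ?_)
  rintro M (rfl | rfl | rfl)
  · exact ⟨![1, 0, 0], by simp [Fin.forall_fin_succ, Fin.sum_univ_succ]⟩
  · exact ⟨![0, 1, 0], by simp [Fin.forall_fin_succ, Fin.sum_univ_succ]⟩
  · exact ⟨![0, 0, 1], by simp [Fin.forall_fin_succ, Fin.sum_univ_succ]⟩

theorem hasRank_o11T : HasRank (Submodule.span F {E F 0 0, E F 0 1 + E F 1 0, E F 1 1}) 3 := by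
  refine hasRank_of_finrank (finrank_canonical (X := .o11T) rfl)
    (spanned_span ![![1, 0], ![1, 1], ![0, 1]] ![![1, 0, 0], ![1, 1, 0], ![0, 1, 0]] ?_)
  rintro M (rfl | rfl | rfl)
  · exact ⟨![1, 0, 0], by simp [Fin.forall_fin_succ, Fin.sum_univ_succ]⟩
  · exact ⟨![-1, 1, -1], by simp [Fin.forall_fin_succ, Fin.sum_univ_succ]⟩
  · exact ⟨![0, 0, 1], by simp [Fin.forall_fin_succ, Fin.sum_univ_succ]⟩

theorem hasRank_o14 : HasRank (Submodule.span F {E F 0 0, E F 0 1 + E F 1 1, E F 1 2}) 3 := by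
  refine hasRank_of_finrank (finrank_canonical (X := .o14) rfl)
    (spanned_span ![![1, 0], ![1, 1], ![0, 1]] ![![1, 0, 0], ![0, 1, 0], ![0, 0, 1]] ?_)
  rintro M (rfl | rfl | rfl)
  · exact ⟨![1, 0, 0], by simp [Fin.forall_fin_succ, Fin.sum_univ_succ]⟩
  · exact ⟨![0, 1, 0], by simp [Fin.forall_fin_succ, Fin.sum_univ_succ]⟩
  · exact ⟨![0, 0, 1], by simp [Fin.forall_fin_succ, Fin.sum_univ_succ]⟩

theorem hasRank_o6 : HasRank (Submodule.span F {E F 0 0 + E F 1 1, E F 1 0}) 3 := by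
  refine hasRank_of_finrank_succ (finrank_canonical (X := .o6) rfl)
    (spanned_span ![![1, 0], ![0, 1], ![0, 1]] ![![1, 0, 0], ![0, 1, 0], ![1, 0, 0]] ?_)
    (entry 0 0) ⟨_, Submodule.subset_span (Or.inl rfl), by simp⟩
    (entry_zero_zero_eq_zero_of_pair fun p q a b h => ?_)
  · rintro M (rfl | rfl)
    · exact ⟨![1, 1, 0], by simp [Fin.forall_fin_succ, Fin.sum_univ_succ]⟩
    · exact ⟨![0, 0, 1], by simp [Fin.forall_fin_succ, Fin.sum_univ_succ]⟩
  · simp [Fin.forall_fin_succ] at h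
    grind

theorem hasRank_o7 : HasRank (Submodule.span F {E F 0 0 + E F 1 2, E F 0 1}) 3 := by
  refine hasRank_of_finrank_succ (finrank_canonical (X := .o7) rfl)
    (spanned_span ![![1, 0], ![0, 1], ![1, 0]] ![![1, 0, 0], ![0, 0, 1], ![0, 1, 0]] ?_)
    (entry 0 0) ⟨_, Submodule.subset_span (Or.inl rfl), by simp⟩
    (entry_zero_zero_eq_zero_of_pair fun p q a b h => ?_)
  · rintro M (rfl | rfl)
    · exact ⟨![1, 1, 0], by simp [Fin.forall_fin_succ, Fin.sum_univ_succ]⟩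
    · exact ⟨![0, 0, 1], by simp [Fin.forall_fin_succ, Fin.sum_univ_succ]⟩
  · simp [Fin.forall_fin_succ] at h
    grind

theorem hasRank_o11 : HasRank (Submodule.span F {E F 0 0 + E F 1 1, E F 0 1 + E F 1 2}) 3 := by
  refine hasRank_of_finrank_succ (finrank_canonical (X := .o11) rfl) spanned_o11
    (entry 0 0) ⟨_, Submodule.subset_span (Or.inl rfl), by simp⟩
    (entry_zero_zero_eq_zero_of_pair fun p q a b h => ?_)
  simp [Fin.forall_fin_succ] at h
  grind

theorem hasRank_o9 : HasRank (Submodule.span F {E F 1 0, E F 1 1, E F 0 0 + E F 1 2}) 4 := by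
  refine hasRank_of_finrank_succ (finrank_canonical (X := .o9) rfl)
    (spanned_span ![![0, 1], ![0, 1], ![1, 0], ![0, 1]]
      ![![1, 0, 0], ![0, 1, 0], ![1, 0, 0], ![0, 0, 1]] ?_)
    (entry 0 0) ⟨_, Submodule.subset_span (Or.inr (Or.inr rfl)), by simp⟩
    (entry_zero_zero_eq_zero_of_triple fun p q s a b h => ?_)
  · rintro M (rfl | rfl | rfl)
    · exact ⟨![1, 0, 0, 0], by simp [Fin.forall_fin_succ, Fin.sum_univ_succ]⟩
    · exact ⟨![0, 1, 0, 0], by simp [Fin.forall_fin_succ, Fin.sum_univ_succ]⟩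
    · exact ⟨![0, 0, 1, 1], by simp [Fin.forall_fin_succ, Fin.sum_univ_succ]⟩
  · simp [Fin.forall_fin_succ] at h
    grind

theorem hasRank_o12 : HasRank (Submodule.span F {E F 0 0 + E F 1 2, E F 0 1, E F 1 1}) 4 := by
  refine hasRank_of_finrank_succ (finrank_canonical (X := .o12) rfl)
    (spanned_span ![![1, 0], ![0, 1], ![1, 0], ![0, 1]]
      ![![1, 0, 0], ![0, 0, 1], ![0, 1, 0], ![0, 1, 0]] ?_)
    (entry 0 0) ⟨_, Submodule.subset_span (Or.inl rfl), by simp⟩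
    (entry_zero_zero_eq_zero_of_triple fun p q s a b h => ?_)
  · rintro M (rfl | rfl | rfl)
    · exact ⟨![1, 1, 0, 0], by simp [Fin.forall_fin_succ, Fin.sum_univ_succ]⟩
    · exact ⟨![0, 0, 1, 0], by simp [Fin.forall_fin_succ, Fin.sum_univ_succ]⟩
    · exact ⟨![0, 0, 0, 1], by simp [Fin.forall_fin_succ, Fin.sum_univ_succ]⟩
  · simp [Fin.forall_fin_succ] at h
    grind

theorem hasRank_o13 : HasRank (Submodule.span F {E F 0 0 + E F 1 1, E F 0 1, E F 1 2}) 4 := by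
  refine hasRank_of_finrank_succ (finrank_canonical (X := .o13) rfl)
    (spanned_span ![![1, 0], ![0, 1], ![1, 0], ![0, 1]]
      ![![1, 0, 0], ![0, 1, 0], ![0, 1, 0], ![0, 0, 1]] ?_)
    (entry 0 0) ⟨_, Submodule.subset_span (Or.inl rfl), by simp⟩
    (entry_zero_zero_eq_zero_of_triple fun p q s a b h => ?_)
  · rintro M (rfl | rfl | rfl)
    · exact ⟨![1, 1, 0, 0], by simp [Fin.forall_fin_succ, Fin.sum_univ_succ]⟩
    · exact ⟨![0, 0, 1, 0], by simp [Fin.forall_fin_succ, Fin.sum_univ_succ]⟩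
    · exact ⟨![0, 0, 0, 1], by simp [Fin.forall_fin_succ, Fin.sum_univ_succ]⟩
  · simp [Fin.forall_fin_succ] at h
    grind

theorem hasRank_o16 : HasRank (Submodule.span F {E F 0 0 + E F 1 1, E F 0 1 + E F 1 2, E F 0 2}) 4 := by
  refine hasRank_of_finrank_succ (finrank_canonical (X := .o16) rfl) spanned_o16
    (entry 0 0) ⟨_, Submodule.subset_span (Or.inl rfl), by simp⟩
    (entry_zero_zero_eq_zero_of_triple fun p q s a b h => ?_)
  simp [Fin.forall_fin_succ] at h
  grind

theorem hasRank_canonical {X : OrbitName} (h17 : X ≠ .o17) (h11p : X ≠ .o11p)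
    {C : Submodule F (V23 F)} (hC : C ∈ canonical F X) : HasRank C (tableRank X) := by
  have hd := finrank_canonical hC
  cases X
  case o17 => exact absurd rfl h17
  case o11p => exact absurd rfl h11p
  case o10p => obtain ⟨u, v, huv, rfl⟩ := hC; exact hasRank_o10p huv
  case o10 => obtain ⟨u, v, huv, rfl⟩ := hC; exact hasRank_o10 huv
  case o15 => obtain ⟨u, v, huv, rfl⟩ := hC; exact hasRank_o15 huv
  all_goals obtain rfl := hC
  case o0p => exact hasRank_o0p
  case o6p => exact hasRank_o6p
  case o1p => exact hasRank_of_finrank hd spanned_o1p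
  case o4p => exact hasRank_of_finrank hd spanned_o4p
  case o2p => exact hasRank_of_finrank hd spanned_o2p
  case o4Tp => exact hasRank_of_finrank hd spanned_o4Tp
  case o5p => exact hasRank_of_finrank hd spanned_o5p
  case o7p => exact hasRank_of_finrank hd spanned_o7p
  case o0 => exact hasRank_of_finrank hd ⟨0, 0, bot_le⟩
  case o1 => exact hasRank_o1
  case o4 => exact hasRank_o4
  case o2 => exact hasRank_o2
  case o4T => exact hasRank_o4T
  case o5 => exact hasRank_o5
  case o3 => exact hasRank_o3
  case o7T => exact hasRank_o7T
  case o8 => exact hasRank_o8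
  case o11T => exact hasRank_o11T
  case o14 => exact hasRank_o14
  case o6 => exact hasRank_o6
  case o7 => exact hasRank_o7
  case o11 => exact hasRank_o11
  case o9 => exact hasRank_o9
  case o12 => exact hasRank_o12
  case o13 => exact hasRank_o13
  case o16 => exact hasRank_o16

end Rank

/-! ### The two names whose rank depends on the size of the field -/

section Exceptional

variable {F : Type*} [Field F]

theorem spanned_o17_five (α β γ : F) : Spanned (Submodule.span F {E F 0 0 + E F 1 1,
    E F 0 1 + E F 1 2, E F 0 2 + α • E F 1 0 + β • E F 1 1 + γ • E F 1 2}) 5 := by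
  refine spanned_span ![![1, 0], ![1, 1], ![0, 1], ![1, 0], ![0, 1]]
    ![![1, -1, 0], ![0, 1, 0], ![0, -1, 1], ![0, 0, 1], ![α, β, γ]] ?_
  rintro M (rfl | rfl | rfl)
  · exact ⟨![1, 1, 0, 0, 0], by simp [Fin.forall_fin_succ, Fin.sum_univ_succ]⟩
  · exact ⟨![0, 1, 1, 0, 0], by simp [Fin.forall_fin_succ, Fin.sum_univ_succ]⟩
  · exact ⟨![0, 0, 0, 1, 1], by simp [Fin.forall_fin_succ, Fin.sum_univ_succ]⟩

/-- Weights at the nodes `0, 1, c` with prescribed moments. -/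
theorem exists_moments {c : F} (h0 : c ≠ 0) (h1 : c ≠ 1) (m₀ m₁ m₂ : F) :
    ∃ w₀ w₁ w : F, w₀ + w₁ + w = m₀ ∧ w₁ + w * c = m₁ ∧ w₁ + w * c ^ 2 = m₂ := by
  have h1' : c - 1 ≠ 0 := sub_ne_zero.2 h1
  refine ⟨m₀ - (m₁ - (m₂ - m₁) / (c * (c - 1)) * c) - (m₂ - m₁) / (c * (c - 1)),
    m₁ - (m₂ - m₁) / (c * (c - 1)) * c, (m₂ - m₁) / (c * (c - 1)), ?_, ?_, ?_⟩
  · ring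
  · ring
  · field_simp
    ring

/-- The tensors are `(1, t) ⊗ (t ^ 2 - γ t - β, t - γ, 1)` at `t = 0, 1, c`, together with `(0, 1) ⊗
(1, 0, 0)`. For a weighted sum over `t` with moments `m₀, m₁, m₂`, the entries 02, 12, 01, 11, 00
are `m₀`, `m₁`, `m₁ - γ m₀`, `m₂ - γ m₁`, `m₂ - γ m₁ - β m₀`. This dictates the moments for each
generator, and the last tensor corrects entry 10. -/
theorem spanned_o17_four {c : F} (h0 : c ≠ 0) (h1 : c ≠ 1) (α β γ : F) :
    Spanned (Submodule.span F {E F 0 0 + E F 1 1,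
      E F 0 1 + E F 1 2, E F 0 2 + α • E F 1 0 + β • E F 1 1 + γ • E F 1 2}) 4 := by
  refine spanned_span ![![0, 1], ![1, 0], ![1, 1], ![1, c]]
    ![![1, 0, 0], ![-β, -γ, 1], ![1 - γ - β, 1 - γ, 1], ![c ^ 2 - γ * c - β, c - γ, 1]] ?_
  rintro M (rfl | rfl | rfl)
  · obtain ⟨w₀, w₁, w, hw⟩ := exists_moments h0 h1 0 0 1
    refine ⟨![-(w₁ * (1 - γ - β) + w * (c * (c ^ 2 - γ * c - β))), w₀, w₁, w], ?_⟩
    simp [Fin.forall_fin_succ, Fin.sum_univ_succ]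
    grind
  · obtain ⟨w₀, w₁, w, hw⟩ := exists_moments h0 h1 0 1 γ
    refine ⟨![-(w₁ * (1 - γ - β) + w * (c * (c ^ 2 - γ * c - β))), w₀, w₁, w], ?_⟩
    simp [Fin.forall_fin_succ, Fin.sum_univ_succ]
    grind
  · obtain ⟨w₀, w₁, w, hw⟩ := exists_moments h0 h1 1 γ (γ ^ 2 + β)
    refine ⟨![α - (w₁ * (1 - γ - β) + w * (c * (c ^ 2 - γ * c - β))), w₀, w₁, w], ?_⟩
    simp [Fin.forall_fin_succ, Fin.sum_univ_succ]
    grind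

theorem entry_zero_zero_eq_zero_of_tmul_mem_o17 {α β γ : F} (h : AdmissibleCubic F α β γ) :
    ∀ a b, a ⊗ₜ[F] b ∈ Submodule.span F {E F 0 0 + E F 1 1, E F 0 1 + E F 1 2,
      E F 0 2 + α • E F 1 0 + β • E F 1 1 + γ • E F 1 2} → entry 0 0 (a ⊗ₜ[F] b) = 0 := by
  refine entry_zero_zero_eq_zero_of_triple fun p q s a b hab => ?_
  simp [Fin.forall_fin_succ] at hab
  by_contra hne
  obtain ⟨ha, hb⟩ := mul_ne_zero_iff.1 hne
  -- With `t = a 1 / a 0`, row 1 is `t` times row 0; solving from the last column backwards gives `t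
  -- ^ 3 - γ t ^ 2 - β t - α = 0`, which is the excluded cubic at `-t` up to sign.
  refine h (-(a 1 / a 0)) ?_
  field_simp
  grind

theorem hasRank_o17_four {c : F} (h0 : c ≠ 0) (h1 : c ≠ 1) {α β γ : F}
    (h : AdmissibleCubic F α β γ) : HasRank (Submodule.span F {E F 0 0 + E F 1 1,
      E F 0 1 + E F 1 2, E F 0 2 + α • E F 1 0 + β • E F 1 1 + γ • E F 1 2}) 4 :=
  hasRank_of_finrank_succ (finrank_canonical (X := .o17) ⟨α, β, γ, h, rfl⟩)
    (spanned_o17_four h0 h1 α β γ) (entry 0 0) ⟨_, Submodule.subset_span (Or.inl rfl), by simp⟩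
    (entry_zero_zero_eq_zero_of_tmul_mem_o17 h)

/-- The tensors `(t, 1) ⊗ (1, -t, t ^ 2)` run over a twisted cubic in this space, with `(1, 0) ⊗ (0,
0, 1)` as the point at infinity. The entries 10, 00, 12, 02 of a member are its moments of orders 0
to 3; nodes `0, 1, c` match the first three and the point at infinity the last. -/
theorem spanned_o11p_four {c : F} (h0 : c ≠ 0) (h1 : c ≠ 1) :
    Spanned (perp F (Submodule.span F {E F 0 0 + E F 1 1, E F 0 1 + E F 1 2})) 4 := by
  refine spanned_of_sum ![![1, 0], ![0, 1], ![1, 1], ![c, 1]]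
    ![![0, 0, 1], ![1, 0, 0], ![1, -1, 1], ![1, -c, c ^ 2]] fun M hM => ?_
  simp only [mem_perp_span_iff, form_apply] at hM
  simp [Fin.sum_univ_succ] at hM
  obtain ⟨w₀, w₁, w, hw⟩ := exists_moments h0 h1 (entry 1 0 M) (entry 0 0 M) (entry 1 2 M)
  refine ⟨![entry 0 2 M - (w₁ + w * c ^ 3), w₀, w₁, w], ?_⟩
  simp [Fin.forall_fin_succ, Fin.sum_univ_succ]
  grind

theorem spanned_o11p_five :
    Spanned (perp F (Submodule.span F {E F 0 0 + E F 1 1, E F 0 1 + E F 1 2})) 5 := by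
  refine spanned_of_sum ![![1, 0], ![0, 1], ![0, 1], ![1, 1], ![1, 0]]
    ![![0, 0, 1], ![1, 0, 0], ![0, 0, 1], ![1, -1, 0], ![0, 1, 0]] fun M hM => ?_
  simp only [mem_perp_span_iff, form_apply] at hM
  simp [Fin.sum_univ_succ] at hM
  refine ⟨![entry 0 2 M, entry 1 0 M - entry 0 0 M, entry 1 2 M, entry 0 0 M,
    entry 0 1 M + entry 0 0 M], ?_⟩
  simp [Fin.forall_fin_succ, Fin.sum_univ_succ]
  grind

/-- On the twisted cubic point with parameter `t` the functional below takes the value `t - t ^ 2`,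
and at infinity it is zero; so it vanishes at all three points over `F_2`. -/
theorem hasRank_o11p_five (h2 : ∀ x : F, x = 0 ∨ x = 1) :
    HasRank (perp F (Submodule.span F {E F 0 0 + E F 1 1, E F 0 1 + E F 1 2})) 5 := by
  refine hasRank_of_finrank_succ (finrank_canonical (X := .o11p) rfl) spanned_o11p_five
    (entry 0 0 + entry 0 1) ⟨E F 0 0 - E F 1 1, ?_, by simp⟩ fun a b h => ?_
  · simp only [mem_perp_span_iff, form_apply]
    simp [Fin.sum_univ_succ]
  · simp only [mem_perp_span_iff, form_apply] at h
    simp [Fin.sum_univ_succ] at h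
    simp only [LinearMap.add_apply, entry_tmul]
    rcases h2 (a 0) with h0 | h0 <;> rcases h2 (a 1) with h1 | h1 <;> grind

/-- If `a 1 ≠ 0`, put `s = a 0 / a 1`: the first two equations give `b = b 0 • (1, -s, s ^ 2)`, and
the third is `b 0` times the excluded cubic at `s`. -/
theorem tmul_eq_zero_of_mem_perp_o17 {α β γ : F} (h : AdmissibleCubic F α β γ) {a : Fin 2 → F}
    {b : Fin 3 → F} (hab : a ⊗ₜ[F] b ∈ perp F (Submodule.span F {E F 0 0 + E F 1 1,
      E F 0 1 + E F 1 2, E F 0 2 + α • E F 1 0 + β • E F 1 1 + γ • E F 1 2})) :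
    a ⊗ₜ[F] b = 0 := by
  simp only [mem_perp_span_iff, form_apply] at hab
  simp [Fin.sum_univ_succ] at hab
  obtain ⟨e1, e2, e3⟩ := hab
  refine ext_entry ?_
  simp only [entry_tmul, map_zero, Fin.forall_fin_succ]
  by_cases ha : a 1 = 0
  · simp; grind
  · have h' := h (a 0 / a 1)
    have hb : b 0 = 0 := by
      by_contra hb
      refine h' ?_
      field_simp
      grind
    simp
    grind

end Exceptional

/-! ### Recognising a canonical form from adapted bases -/

section Frames

variable {F : Type*} [Field F]

/-- `U` lies in the orbit of a canonical subspace with the name `X`. -/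
def IsNamed (U : Submodule F (V23 F)) (X : OrbitName) : Prop :=
  ∃ C ∈ canonical F X, Equivalent U C

theorem IsNamed.nameDim_eq {U : Submodule F (V23 F)} {X : OrbitName} (h : IsNamed U X) :
    nameDim X = Module.finrank F U := by
  obtain ⟨C, hC, hU⟩ := h
  rw [hU.finrank_eq, finrank_canonical hC]

/-- The linear map sending `e_i ⊗ e_j` to `f_i ⊗ h_j`. -/
noncomputable def frameMap (f : Fin 2 → Fin 2 → F) (h : Fin 3 → Fin 3 → F) : V23 F →ₗ[F] V23 F :=
  TensorProduct.map (Fintype.linearCombination F f) (Fintype.linearCombination F h)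

@[simp]
theorem frameMap_E (f : Fin 2 → Fin 2 → F) (h : Fin 3 → Fin 3 → F) (i : Fin 2) (j : Fin 3) :
    frameMap f h (E F i j) = f i ⊗ₜ[F] h j := by
  simp [frameMap, E]

theorem exists_equiv_linearCombination {n : ℕ} {f : Fin n → Fin n → F}
    (hf : LinearIndependent F f) : ∃ g : (Fin n → F) ≃ₗ[F] (Fin n → F),
      ∀ c, g (Fintype.linearCombination F f c) = c := by
  classical
  refine ⟨(basisOfPiSpaceOfLinearIndependent hf).equivFun, fun c => ?_⟩
  rw [← LinearEquiv.eq_symm_apply, Module.Basis.equivFun_symm_apply,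
    Fintype.linearCombination_apply]
  simp

/-- Containment of the transported generators is enough, because equality of dimensions upgrades it
to equality. Each classification case thus only has to exhibit two bases. -/
theorem isNamed_of_frame {X : OrbitName} {S : Set (V23 F)}
    (hC : Submodule.span F S ∈ canonical F X) {f : Fin 2 → Fin 2 → F} {h : Fin 3 → Fin 3 → F}
    (hf : LinearIndependent F f) (hh : LinearIndependent F h) {U : Submodule F (V23 F)}
    (hd : Module.finrank F U = nameDim X) (hS : ∀ M ∈ S, frameMap f h M ∈ U) : IsNamed U X := by
  obtain ⟨g₁, h₁⟩ := exists_equiv_linearCombination hf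
  obtain ⟨g₂, h₂⟩ := exists_equiv_linearCombination hh
  refine ⟨_, hC, g₁, g₂, (Submodule.eq_of_le_of_finrank_eq ?_ ?_).symm⟩
  · refine Submodule.span_le.2 fun M hM => ⟨frameMap f h M, hS M hM, ?_⟩
    have key : (TensorProduct.congr g₁ g₂).toLinearMap ∘ₗ frameMap f h = LinearMap.id :=
      TensorProduct.ext' fun a b => by simp [frameMap, h₁, h₂]
    exact congrArg (fun φ => φ M) key
  · have := LinearEquiv.finrank_map_eq (TensorProduct.congr g₁ g₂) U
    rw [this, hd, finrank_canonical hC]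

theorem linearIndependent_triple_iff {V : Type*} [AddCommGroup V] [Module F V] {x y z : V} :
    LinearIndependent F ![x, y, z] ↔
      ∀ a b c : F, a • x + b • y + c • z = 0 → a = 0 ∧ b = 0 ∧ c = 0 := by
  rw [Fintype.linearIndependent_iff]
  constructor
  · intro h a b c habc
    have := h ![a, b, c] (by simpa [Fin.sum_univ_succ, add_assoc] using habc)
    exact ⟨this 0, this 1, this 2⟩
  · intro h g hg
    have := h (g 0) (g 1) (g 2) (by simpa [Fin.sum_univ_succ, add_assoc] using hg)
    intro i
    fin_cases i
    exacts [this.1, this.2.1, this.2.2]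

theorem linearIndependent_pair_of_det_ne_zero {V : Type*} [AddCommGroup V] [Module F V]
    {x y x' y' : V} (h : LinearIndependent F ![x, y]) (a b c d : F) (hdet : a * d - b * c ≠ 0)
    (hx : x' = a • x + b • y) (hy : y' = c • x + d • y) : LinearIndependent F ![x', y'] := by
  subst hx hy
  rw [LinearIndependent.pair_iff] at h ⊢
  intro p q e
  obtain ⟨e₁, e₂⟩ := h (p * a + q * c) (p * b + q * d) (by rw [← e]; module)
  exact ⟨(mul_eq_zero_iff_left hdet).1 (by linear_combination d * e₁ - c * e₂),
    (mul_eq_zero_iff_left hdet).1 (by linear_combination a * e₂ - b * e₁)⟩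

theorem linearIndependent_triple_of_det_ne_zero {V : Type*} [AddCommGroup V] [Module F V]
    {x y z x' y' z' : V} (h : LinearIndependent F ![x, y, z])
    (a₁ a₂ a₃ b₁ b₂ b₃ c₁ c₂ c₃ : F)
    (hdet : a₁ * (b₂ * c₃ - b₃ * c₂) - a₂ * (b₁ * c₃ - b₃ * c₁) + a₃ * (b₁ * c₂ - b₂ * c₁) ≠ 0)
    (hx : x' = a₁ • x + a₂ • y + a₃ • z) (hy : y' = b₁ • x + b₂ • y + b₃ • z)
    (hz : z' = c₁ • x + c₂ • y + c₃ • z) : LinearIndependent F ![x', y', z'] := by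
  subst hx hy hz
  rw [linearIndependent_triple_iff] at h ⊢
  intro p q r e
  obtain ⟨e₁, e₂, e₃⟩ := h (p * a₁ + q * b₁ + r * c₁) (p * a₂ + q * b₂ + r * c₂)
    (p * a₃ + q * b₃ + r * c₃) (by rw [← e]; module)
  exact ⟨(mul_eq_zero_iff_left hdet).1 (by
      linear_combination (b₂ * c₃ - b₃ * c₂) * e₁ - (b₁ * c₃ - b₃ * c₁) * e₂ +
        (b₁ * c₂ - b₂ * c₁) * e₃),
    (mul_eq_zero_iff_left hdet).1 (by
      linear_combination -(a₂ * c₃ - a₃ * c₂) * e₁ + (a₁ * c₃ - a₃ * c₁) * e₂ -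
        (a₁ * c₂ - a₂ * c₁) * e₃),
    (mul_eq_zero_iff_left hdet).1 (by
      linear_combination (a₂ * b₃ - a₃ * b₂) * e₁ - (a₁ * b₃ - a₃ * b₁) * e₂ +
        (a₁ * b₂ - a₂ * b₁) * e₃)⟩

theorem exists_linearIndependent_pair {x : Fin 2 → F} (hx : x ≠ 0) :
    ∃ y, LinearIndependent F ![x, y] :=
  exists_linearIndependent_pair_of_one_lt_finrank (by simp) hx

theorem exists_linearIndependent_triple {x y : Fin 3 → F} (h : LinearIndependent F ![x, y]) :
    ∃ z, LinearIndependent F ![x, y, z] := by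
  obtain ⟨z, hz⟩ := exists_linearIndependent_cons_of_lt_finrank h (by simp)
  refine ⟨z, linearIndependent_triple_iff.2 fun a b c e => ?_⟩
  have := linearIndependent_triple_iff.1 hz c a b (by rw [← e]; module)
  tauto

theorem exists_linearIndependent_triple_of_ne_zero {x : Fin 3 → F} (hx : x ≠ 0) :
    ∃ y z, LinearIndependent F ![x, y, z] := by
  obtain ⟨y, hy⟩ := exists_linearIndependent_pair_of_one_lt_finrank (R := F)
    (M := Fin 3 → F) (by simp) hx
  exact ⟨y, exists_linearIndependent_triple hy⟩

theorem eq_smul_of_not_linearIndependent_pair {V : Type*} [AddCommGroup V] [Module F V] {x y : V}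
    (hx : x ≠ 0) (h : ¬ LinearIndependent F ![x, y]) : ∃ a : F, y = a • x := by
  rw [LinearIndependent.pair_iff' hx] at h
  push Not at h
  obtain ⟨a, ha⟩ := h
  exact ⟨a, ha.symm⟩

theorem eq_of_not_linearIndependent_triple {V : Type*} [AddCommGroup V] [Module F V] {x y z : V}
    (hxy : LinearIndependent F ![x, y]) (h : ¬ LinearIndependent F ![x, y, z]) :
    ∃ a b : F, z = a • x + b • y := by
  rw [linearIndependent_triple_iff] at h
  push Not at h
  obtain ⟨a, b, c, e, hne⟩ := h
  have hc : c ≠ 0 := by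
    rintro rfl
    have := LinearIndependent.pair_iff.1 hxy a b (by rw [← e]; module)
    exact hne this.1 this.2 rfl
  refine ⟨-(a / c), -(b / c), ?_⟩
  have hz : z = c⁻¹ • (c • z) := (inv_smul_smul₀ hc z).symm
  rw [hz, eq_neg_of_add_eq_zero_right e]
  match_scalars <;> field_simp

theorem exists_eq_of_linearIndependent_triple {x y z : Fin 3 → F}
    (h : LinearIndependent F ![x, y, z]) (w : Fin 3 → F) :
    ∃ a b c : F, w = a • x + b • y + c • z := by
  have hs := h.span_eq_top_of_card_eq_finrank (by simp)
  have hw : w ∈ Submodule.span F (Set.range ![x, y, z]) := hs ▸ Submodule.mem_top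
  obtain ⟨c, hc⟩ := (Submodule.mem_span_range_iff_exists_fun F).1 hw
  exact ⟨c 0, c 1, c 2, by simp [← hc, Fin.sum_univ_succ, add_assoc]⟩

/-- The two rows of a matrix with respect to a basis of `F^2`. -/
theorem exists_rows {f₁ f₂ : Fin 2 → F} (hf : LinearIndependent F ![f₁, f₂]) :
    ∃ R₁ R₂ : V23 F →ₗ[F] (Fin 3 → F), ∀ M, M = f₁ ⊗ₜ[F] R₁ M + f₂ ⊗ₜ[F] R₂ M := by
  classical
  let b := basisOfPiSpaceOfLinearIndependent hf
  refine ⟨(TensorProduct.lid F (Fin 3 → F)).toLinearMap ∘ₗ LinearMap.rTensor _ (b.coord 0),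
    (TensorProduct.lid F (Fin 3 → F)).toLinearMap ∘ₗ LinearMap.rTensor _ (b.coord 1),
    fun M => ?_⟩
  induction M using TensorProduct.induction_on with
  | zero => simp
  | add x y hx hy =>
    simp only [map_add, TensorProduct.tmul_add]
    conv_lhs => rw [hx, hy]
    abel
  | tmul a c =>
    have ha : a = b.repr a 0 • f₁ + b.repr a 1 • f₂ := by
      conv_lhs => rw [← b.sum_repr a]
      simp [b]
    simp only [LinearMap.comp_apply, LinearMap.rTensor_tmul, LinearEquiv.coe_coe,
      TensorProduct.lid_tmul, Module.Basis.coord_apply, ← TensorProduct.smul_tmul]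
    rw [← TensorProduct.add_tmul, ← ha]

theorem tmul_add_tmul_eq_zero {f₁ f₂ : Fin 2 → F} (hf : LinearIndependent F ![f₁, f₂])
    {y z : Fin 3 → F} (h : f₁ ⊗ₜ[F] y + f₂ ⊗ₜ[F] z = 0) : y = 0 ∧ z = 0 := by
  obtain ⟨g, hg⟩ := exists_equiv_linearCombination hf
  have h₁ : g f₁ = ![1, 0] := by simpa [Fintype.linearCombination_apply] using hg ![1, 0]
  have h₂ : g f₂ = ![0, 1] := by simpa [Fintype.linearCombination_apply] using hg ![0, 1]
  have h' := congrArg (TensorProduct.congr g (LinearEquiv.refl F (Fin 3 → F))) h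
  simp only [map_add, TensorProduct.congr_tmul, h₁, h₂, map_zero, LinearEquiv.refl_apply] at h'
  constructor
  · ext j
    simpa using congrArg (entry 0 j) h'
  · ext j
    simpa using congrArg (entry 1 j) h'

theorem linearIndependent_or_eq_tmul (f₁ f₂ : Fin 2 → F) (y z : Fin 3 → F) :
    LinearIndependent F ![y, z] ∨ ∃ a b, f₁ ⊗ₜ[F] y + f₂ ⊗ₜ[F] z = a ⊗ₜ[F] b := by
  by_cases hy : y = 0
  · exact .inr ⟨f₂, z, by simp [hy]⟩
  · by_cases hli : LinearIndependent F ![y, z]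
    · exact .inl hli
    · obtain ⟨c, rfl⟩ := eq_smul_of_not_linearIndependent_pair hy hli
      exact .inr ⟨f₁ + c • f₂, y, by rw [TensorProduct.add_tmul, TensorProduct.smul_tmul]⟩

theorem exists_mem_notMem_span {S : Finset (V23 F)} {U : Submodule F (V23 F)}
    (h : S.card < Module.finrank F U) : ∃ N ∈ U, N ∉ Submodule.span F (S : Set (V23 F)) := by
  by_contra! hU
  exact absurd ((Submodule.finrank_mono hU).trans (finrank_span_finset_le_card S)) (not_le.2 h)

theorem linearIndependent_single : LinearIndependent F
    ![(Pi.single 0 1 : Fin 2 → F), Pi.single 1 1] := by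
  rw [LinearIndependent.pair_iff]
  intro a b h
  exact ⟨by simpa using congrFun h 0, by simpa using congrFun h 1⟩

/-! ### Subspaces of dimension one and two -/

theorem exists_isNamed_of_finrank_eq_one {U : Submodule F (V23 F)}
    (hd : Module.finrank F U = 1) : ∃ X, IsNamed U X := by
  obtain ⟨N, hN, hN0⟩ := exists_mem_notMem_span (S := ∅) (U := U) (by simp [hd])
  replace hN0 : N ≠ 0 := by simpa using hN0
  obtain ⟨R₁, R₂, hR⟩ := exists_rows (F := F) linearIndependent_single
  rcases linearIndependent_or_eq_tmul (Pi.single 0 1) (Pi.single 1 1) (R₁ N) (R₂ N) with h | h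
  · obtain ⟨z, hz⟩ := exists_linearIndependent_triple h
    refine ⟨.o4, isNamed_of_frame (F := F) (X := .o4) rfl linearIndependent_single hz hd ?_⟩
    rintro M rfl
    simp only [map_add, frameMap_E]
    exact hR N ▸ hN
  · obtain ⟨a, b, hab⟩ := h
    rw [hR N, hab] at hN hN0
    obtain ⟨a', ha⟩ := exists_linearIndependent_pair (x := a) (by rintro rfl; simp at hN0)
    obtain ⟨b', b'', hb⟩ := exists_linearIndependent_triple_of_ne_zero (x := b)
      (by rintro rfl; simp at hN0)
    refine ⟨.o1, isNamed_of_frame (F := F) (X := .o1) rfl ha hb hd ?_⟩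
    rintro M rfl
    simpa using hN

/-- The name depends on how the rows `y`, `z` of a second generator lie relative to `h₁`: `o2` for
`z = 0`; `o7` or `o5` for `z` independent of `h₁`, as `y` is outside or inside their span; `o6` or
`o4T` for `z` parallel to `h₁`. -/
theorem exists_isNamed_of_tmul_mem {U : Submodule F (V23 F)}
    (hd : Module.finrank F U = 2) {f₁ : Fin 2 → F} {h₁ : Fin 3 → F} (hf₁ : f₁ ≠ 0) (hh₁ : h₁ ≠ 0)
    (hU : f₁ ⊗ₜ[F] h₁ ∈ U) : ∃ X, IsNamed U X := by
  obtain ⟨f₂, hf⟩ := exists_linearIndependent_pair hf₁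
  obtain ⟨N, hN, hNs⟩ := exists_mem_notMem_span (S := {f₁ ⊗ₜ[F] h₁}) (U := U) (by simp [hd])
  obtain ⟨R₁, R₂, hR⟩ := exists_rows hf
  have hNR := hR N
  generalize R₁ N = y at hNR
  generalize R₂ N = z at hNR
  subst hNR
  have hns : ∀ c : F, f₁ ⊗ₜ[F] y + f₂ ⊗ₜ[F] z ≠ c • f₁ ⊗ₜ[F] h₁ := fun c hc => hNs <| by
    rw [hc]; exact Submodule.smul_mem _ _ (Submodule.subset_span (by simp))
  by_cases hz : z = 0
  · subst hz
    rw [TensorProduct.tmul_zero, add_zero] at hN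
    have hli : LinearIndependent F ![h₁, y] := by
      by_contra hli
      obtain ⟨c, rfl⟩ := eq_smul_of_not_linearIndependent_pair hh₁ hli
      exact hns c (by simp)
    obtain ⟨w, hw⟩ := exists_linearIndependent_triple hli
    refine ⟨.o2, isNamed_of_frame (F := F) (X := .o2) rfl hf hw hd ?_⟩
    rintro M (rfl | rfl)
    · simpa using hU
    · simpa using hN
  by_cases hli : LinearIndependent F ![h₁, z]
  · by_cases hli3 : LinearIndependent F ![h₁, z, y]
    · refine ⟨.o7, isNamed_of_frame (F := F) (X := .o7) (h := ![y, h₁, z]) rfl hf ?_ hd ?_⟩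
      · exact linearIndependent_triple_of_det_ne_zero hli3 0 0 1 1 0 0 0 1 0 (by simp)
          (by simp) (by simp) (by simp)
      · rintro M (rfl | rfl)
        · simpa using hN
        · simpa using hU
    · obtain ⟨a, b, rfl⟩ := eq_of_not_linearIndependent_triple hli hli3
      obtain ⟨w, hw⟩ := exists_linearIndependent_triple hli
      refine ⟨.o5, isNamed_of_frame (F := F) (X := .o5) (f := ![f₁, b • f₁ + f₂]) rfl ?_ hw hd ?_⟩
      · exact linearIndependent_pair_of_det_ne_zero hf 1 0 b 1 (by simp) (by simp) (by simp)
      · rintro M (rfl | rfl)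
        · simpa using hU
        · have := U.sub_mem hN (U.smul_mem a hU)
          convert this using 1
          simp [TensorProduct.add_tmul, TensorProduct.tmul_add, TensorProduct.smul_tmul]
          abel
  · obtain ⟨c, rfl⟩ := eq_smul_of_not_linearIndependent_pair hh₁ hli
    have hc : c ≠ 0 := by rintro rfl; simp at hz
    by_cases hli' : LinearIndependent F ![h₁, y]
    · obtain ⟨w, hw⟩ := exists_linearIndependent_triple hli'
      refine ⟨.o6, isNamed_of_frame (F := F) (X := .o6) (f := ![c • f₂, f₁]) rfl ?_ hw hd ?_⟩
      · exact linearIndependent_pair_of_det_ne_zero hf 0 c 1 0 (by simpa) (by simp) (by simp)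
      · rintro M (rfl | rfl)
        · convert hN using 1
          simp [TensorProduct.smul_tmul]
          abel
        · simpa using hU
    · obtain ⟨d, rfl⟩ := eq_smul_of_not_linearIndependent_pair hh₁ hli'
      obtain ⟨w, w', hw⟩ := exists_linearIndependent_triple_of_ne_zero hh₁
      refine ⟨.o4T, isNamed_of_frame (F := F) (X := .o4T) (f := ![f₁, d • f₁ + c • f₂]) rfl ?_ hw hd ?_⟩
      · exact linearIndependent_pair_of_det_ne_zero hf 1 0 d c (by simpa) (by simp) rfl
      · rintro M (rfl | rfl)
        · simpa using hU
        · convert hN using 1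
          simp [TensorProduct.add_tmul, TensorProduct.smul_tmul]

theorem exists_isNamed_of_tmul_notMem {U : Submodule F (V23 F)} (hd : Module.finrank F U = 2)
    (hU : ∀ a b, a ⊗ₜ[F] b ∈ U → a ⊗ₜ[F] b = 0) : IsNamed U .o10 ∨ IsNamed U .o11 := by
  set f₁ : Fin 2 → F := Pi.single 0 1
  set f₂ : Fin 2 → F := Pi.single 1 1
  have hf : LinearIndependent F ![f₁, f₂] := linearIndependent_single
  obtain ⟨R₁, R₂, hR⟩ := exists_rows hf
  have hinj₁ : Function.Injective (R₁ ∘ₗ U.subtype) := by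
    refine (injective_iff_map_eq_zero _).2 fun M hM => ?_
    have hM' : R₁ M = 0 := hM
    have h0 : (M : V23 F) = f₂ ⊗ₜ[F] R₂ M := by conv_lhs => rw [hR M, hM']; simp
    exact Subtype.ext (h0.trans (hU _ _ (h0 ▸ M.2)))
  have hinj₂ : Function.Injective (R₂ ∘ₗ U.subtype) := by
    refine (injective_iff_map_eq_zero _).2 fun M hM => ?_
    have hM' : R₂ M = 0 := hM
    have h0 : (M : V23 F) = f₁ ⊗ₜ[F] R₁ M := by conv_lhs => rw [hR M, hM']; simp
    exact Subtype.ext (h0.trans (hU _ _ (h0 ▸ M.2)))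
  have hr₁ := LinearMap.finrank_range_of_inj hinj₁
  have hr₂ := LinearMap.finrank_range_of_inj hinj₂
  have hsum := Submodule.finrank_sup_add_finrank_inf_eq (LinearMap.range (R₁ ∘ₗ U.subtype))
    (LinearMap.range (R₂ ∘ₗ U.subtype))
  have hle := Submodule.finrank_le (LinearMap.range (R₁ ∘ₗ U.subtype) ⊔
    LinearMap.range (R₂ ∘ₗ U.subtype))
  rw [Module.finrank_fin_fun] at hle
  -- Without rank-one elements both row maps are injective on `U`, so their images are planes in
  -- `F^3`, and these meet. A common vector `h` is the first row of some `N` and the second row of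
  -- some `M`.
  have hne : LinearMap.range (R₁ ∘ₗ U.subtype) ⊓ LinearMap.range (R₂ ∘ₗ U.subtype) ≠ ⊥ := by
    intro h
    rw [h, finrank_bot] at hsum
    omega
  obtain ⟨h, ⟨⟨⟨N, hN⟩, hN'⟩, ⟨⟨M, hM⟩, hM'⟩⟩, hh⟩ := Submodule.exists_mem_ne_zero_of_ne_bot hne
  replace hN' : R₁ N = h := hN'
  replace hM' : R₂ M = h := hM'
  have hMR := hR M
  have hNR := hR N
  rw [hM'] at hMR
  rw [hN'] at hNR
  generalize R₁ M = y at hMR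
  generalize R₂ N = z at hNR
  subst hMR hNR
  have hyh : LinearIndependent F ![h, y] := by
    by_contra hli
    obtain ⟨c, rfl⟩ := eq_smul_of_not_linearIndependent_pair hh hli
    have e : f₁ ⊗ₜ[F] (c • h) + f₂ ⊗ₜ[F] h = (c • f₁ + f₂) ⊗ₜ[F] h := by
      rw [TensorProduct.add_tmul, TensorProduct.smul_tmul]
    have h0 := hU _ _ (e ▸ hM)
    exact hh (tmul_add_tmul_eq_zero hf (e.trans h0)).2
  by_cases hli : LinearIndependent F ![h, y, z]
  · right
    refine isNamed_of_frame (F := F) (X := .o11) (h := ![y, h, z]) rfl hf ?_ hd ?_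
    · exact linearIndependent_triple_of_det_ne_zero hli 0 1 0 1 0 0 0 0 1 (by simp)
        (by simp) (by simp) (by simp)
    · rintro M (rfl | rfl)
      · simpa using hM
      · simpa using hN
  · left
    obtain ⟨q, p, rfl⟩ := eq_of_not_linearIndependent_triple hyh hli
    have hyh' := LinearIndependent.pair_iff.1 hyh
    have hp : p ≠ 0 := by
      rintro rfl
      have e : f₁ ⊗ₜ[F] h + f₂ ⊗ₜ[F] (q • h + (0 : F) • y) = (f₁ + q • f₂) ⊗ₜ[F] h := by
        rw [TensorProduct.add_tmul, TensorProduct.smul_tmul]; simp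
      have h0 := hU _ _ (e ▸ hN)
      exact hh (tmul_add_tmul_eq_zero hf (e.trans h0)).1
    obtain ⟨w, hw⟩ := exists_linearIndependent_triple hyh
    refine isNamed_of_frame (F := F) (X := .o10) (h := ![y + (q / p) • h, h, w])
      ⟨-(q / p), p, ⟨hp, fun t ht => ?_⟩, rfl⟩ hf ?_ hd ?_
    -- A root `t` of the quadratic satisfies `p t ^ 2 = 1 + q t`, which makes `M + t N` a rank-one
    -- element of `U`.
    · have e : (f₁ ⊗ₜ[F] y + f₂ ⊗ₜ[F] h) + t • (f₁ ⊗ₜ[F] h + f₂ ⊗ₜ[F] (q • h + p • y)) =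
          (f₁ + (t * p) • f₂) ⊗ₜ[F] (y + t • h) := by
        have ht' : p * t * t = 1 + q * t := by
          field_simp at ht
          linear_combination ht
        simp only [TensorProduct.add_tmul, TensorProduct.tmul_add, TensorProduct.tmul_smul,
          ← TensorProduct.smul_tmul']
        match_scalars <;> first | ring1 | linear_combination ht' | linear_combination -ht'
      have hmem := U.add_mem hM (U.smul_mem t hN)
      have h0 := hU _ _ (e ▸ hmem)
      rw [← e] at h0
      have h1 := (tmul_add_tmul_eq_zero hf (y := y + t • h) (z := h + t • (q • h + p • y)) (by
        rw [← h0]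
        simp only [TensorProduct.tmul_add, TensorProduct.tmul_smul]
        module)).1
      exact one_ne_zero (hyh' t 1 (by rw [← h1]; module)).2
    · exact linearIndependent_triple_of_det_ne_zero hw (q / p) 1 0 1 0 0 0 0 1 (by simp)
        (by module) (by simp) (by simp)
    · rintro M (rfl | rfl)
      · convert hM using 1
        simp [TensorProduct.tmul_add]
        module
      · convert hN using 1
        simp only [map_add, map_smul, frameMap_E, Matrix.cons_val_zero, Matrix.cons_val_one,
          TensorProduct.tmul_add, TensorProduct.tmul_smul]
        match_scalars <;> field_simp

theorem exists_isNamed_of_finrank_eq_two {U : Submodule F (V23 F)}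
    (hd : Module.finrank F U = 2) : ∃ X, IsNamed U X := by
  by_cases hU : ∀ a b, a ⊗ₜ[F] b ∈ U → a ⊗ₜ[F] b = 0
  · exact (exists_isNamed_of_tmul_notMem hd hU).elim (fun h => ⟨_, h⟩) fun h => ⟨_, h⟩
  · push Not at hU
    obtain ⟨a, b, hab, h0⟩ := hU
    exact exists_isNamed_of_tmul_mem hd (by rintro rfl; simp at h0) (by rintro rfl; simp at h0) hab

end Frames

/-! ### Dimension three: many rank-one tensors, or no eigenvector -/

section DimThree

variable {F : Type*} [Field F]

theorem exists_isNamed_of_three_tmul_mem {U : Submodule F (V23 F)}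
    (hd : Module.finrank F U = 3) {f₁ f₂ : Fin 2 → F} (hf : LinearIndependent F ![f₁, f₂])
    {h₁ h₂ h₃ : Fin 3 → F} (hh₁ : h₁ ≠ 0) (hh₂ : h₂ ≠ 0) (hh₃ : h₃ ≠ 0)
    (hU₁ : f₁ ⊗ₜ[F] h₁ ∈ U) (hU₂ : f₂ ⊗ₜ[F] h₂ ∈ U) (hU₃ : (f₁ + f₂) ⊗ₜ[F] h₃ ∈ U) :
    ∃ X, IsNamed U X := by
  by_cases hli : LinearIndependent F ![h₁, h₂]
  · by_cases hli3 : LinearIndependent F ![h₁, h₂, h₃]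
    · refine ⟨.o14, isNamed_of_frame (F := F) (X := .o14) (h := ![h₁, h₃, h₂]) rfl hf ?_ hd ?_⟩
      · exact linearIndependent_triple_of_det_ne_zero hli3 1 0 0 0 0 1 0 1 0 (by simp)
          (by simp) (by simp) (by simp)
      · rintro M (rfl | rfl | rfl)
        · simpa using hU₁
        · simpa [TensorProduct.add_tmul] using hU₃
        · simpa using hU₂
    · obtain ⟨a, b, rfl⟩ := eq_of_not_linearIndependent_triple hli hli3
      -- Expanding `(f₁ + f₂) ⊗ h₃` and removing the multiples of `f₁ ⊗ h₁` and `f₂ ⊗ h₂` leaves the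
      -- mixed terms.
      have hK : b • f₁ ⊗ₜ[F] h₂ + a • f₂ ⊗ₜ[F] h₁ ∈ U := by
        convert U.sub_mem (U.sub_mem hU₃ (U.smul_mem a hU₁)) (U.smul_mem b hU₂) using 1
        simp only [TensorProduct.add_tmul, TensorProduct.tmul_add, TensorProduct.tmul_smul]
        module
      obtain ⟨w, hw⟩ := exists_linearIndependent_triple hli
      by_cases ha : a = 0
      · subst ha
        have hb : b ≠ 0 := by rintro rfl; simp at hh₃
        rw [zero_smul, add_zero, Submodule.smul_mem_iff _ hb] at hK
        refine ⟨.o7T, isNamed_of_frame (F := F) (X := .o7T) (f := ![f₂, f₁])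
          (h := ![h₂, h₁, w]) rfl ?_ ?_ hd ?_⟩
        · exact linearIndependent_pair_of_det_ne_zero hf 0 1 1 0 (by simp) (by simp) (by simp)
        · exact linearIndependent_triple_of_det_ne_zero hw 0 1 0 1 0 0 0 0 1 (by simp)
            (by simp) (by simp) (by simp)
        · rintro M (rfl | rfl | rfl)
          · simpa using hK
          · simpa using hU₁
          · simpa using hU₂
      by_cases hb : b = 0
      · subst hb
        rw [zero_smul, zero_add, Submodule.smul_mem_iff _ ha] at hK
        refine ⟨.o7T, isNamed_of_frame (F := F) (X := .o7T) rfl hf hw hd ?_⟩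
        rintro M (rfl | rfl | rfl)
        · simpa using hK
        · simpa using hU₂
        · simpa using hU₁
      · refine ⟨.o11T, isNamed_of_frame (F := F) (X := .o11T) (h := ![a • h₁, b • h₂, w])
          rfl hf ?_ hd ?_⟩
        · exact linearIndependent_triple_of_det_ne_zero hw a 0 0 0 b 0 0 0 1 (by simp [ha, hb])
            (by simp) (by simp) (by simp)
        · rintro M (rfl | rfl | rfl)
          · simpa using U.smul_mem a hU₁
          · simpa using hK
          · simpa using U.smul_mem b hU₂
  -- Here `U` contains all of `F^2 ⊗ h₁`, and only the rows of a third generator modulo `h₁` matter.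
  · obtain ⟨c, rfl⟩ := eq_smul_of_not_linearIndependent_pair hh₁ hli
    have hc : c ≠ 0 := by rintro rfl; simp at hh₂
    rw [TensorProduct.tmul_smul, Submodule.smul_mem_iff _ hc] at hU₂
    classical
    obtain ⟨N, hN, hNs⟩ := exists_mem_notMem_span (S := {f₁ ⊗ₜ[F] h₁, f₂ ⊗ₜ[F] h₁}) (U := U)
      (by rw [hd]; exact Nat.lt_succ_of_le Finset.card_le_two)
    obtain ⟨R₁, R₂, hR⟩ := exists_rows hf
    have hNR := hR N
    generalize R₁ N = y at hNR
    generalize R₂ N = z at hNR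
    subst hNR
    rw [Finset.coe_pair, Submodule.mem_span_pair] at hNs
    by_cases hy : LinearIndependent F ![h₁, y]
    · by_cases hz : LinearIndependent F ![h₁, y, z]
      · refine ⟨.o12, isNamed_of_frame (F := F) (X := .o12) (h := ![y, h₁, z]) rfl hf ?_ hd ?_⟩
        · exact linearIndependent_triple_of_det_ne_zero hz 0 1 0 1 0 0 0 0 1 (by simp)
            (by simp) (by simp) (by simp)
        · rintro M (rfl | rfl | rfl)
          · simpa using hN
          · simpa using hU₁
          · simpa using hU₂
      · obtain ⟨a, b, rfl⟩ := eq_of_not_linearIndependent_triple hy hz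
        obtain ⟨w, hw⟩ := exists_linearIndependent_triple hy
        refine ⟨.o7T, isNamed_of_frame (F := F) (X := .o7T) (f := ![f₂, f₁ + b • f₂])
          rfl ?_ hw hd ?_⟩
        · exact linearIndependent_pair_of_det_ne_zero hf 0 1 1 b (by simp) (by simp) (by simp)
        · rintro M (rfl | rfl | rfl)
          · convert U.add_mem hU₁ (U.smul_mem b hU₂) using 1
            simp [TensorProduct.add_tmul, ← TensorProduct.smul_tmul']
          · convert U.sub_mem hN (U.smul_mem a hU₂) using 1
            simp [TensorProduct.add_tmul, TensorProduct.tmul_add, ← TensorProduct.smul_tmul']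
            module
          · simpa using hU₂
    · obtain ⟨d, rfl⟩ := eq_smul_of_not_linearIndependent_pair hh₁ hy
      have hz : LinearIndependent F ![h₁, z] := by
        by_contra hz
        obtain ⟨e, rfl⟩ := eq_smul_of_not_linearIndependent_pair hh₁ hz
        exact hNs ⟨d, e, by simp⟩
      obtain ⟨w, hw⟩ := exists_linearIndependent_triple hz
      refine ⟨.o7T, isNamed_of_frame (F := F) (X := .o7T) rfl hf hw hd ?_⟩
      rintro M (rfl | rfl | rfl)
      · simpa using hU₂
      · convert U.sub_mem hN (U.smul_mem d hU₁) using 1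
        simp
      · simpa using hU₁

/-- Every nonzero `v` is cyclic: an invariant plane would force an eigenvalue on the quotient line,
and hence an eigenvector. In the basis `v, T v, T (T v)` the graph of `T` is the `o17` form. -/
theorem exists_isNamed_of_no_eigenvector {U : Submodule F (V23 F)}
    (hd : Module.finrank F U = 3) {f₁ f₂ : Fin 2 → F} (hf : LinearIndependent F ![f₁, f₂])
    (T : (Fin 3 → F) →ₗ[F] (Fin 3 → F)) (hU : ∀ v, f₁ ⊗ₜ[F] v + f₂ ⊗ₜ[F] T v ∈ U)
    (hT : ∀ v, ∀ s : F, T v = s • v → v = 0) : IsNamed U .o17 := by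
  obtain ⟨v, hv⟩ : ∃ v : Fin 3 → F, v ≠ 0 := exists_ne 0
  have hv1 : LinearIndependent F ![v, T v] :=
    (LinearIndependent.pair_iff' hv).2 fun a ha => hv (hT v a ha.symm)
  have hv1' := LinearIndependent.pair_iff.1 hv1
  have hv2 : LinearIndependent F ![v, T v, T (T v)] := by
    by_contra hli
    obtain ⟨a, b, hab⟩ := eq_of_not_linearIndependent_triple hv1 hli
    obtain ⟨w, hw⟩ := exists_linearIndependent_triple hv1
    obtain ⟨p, q, s, hs⟩ := exists_eq_of_linearIndependent_triple hw (T w)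
    -- The scalar `s` is the action on the quotient by the invariant plane, and the polynomial is
    -- the characteristic polynomial on that plane; a zero would produce the eigenvector `(T - (b -
    -- s)) v`.
    have hP : s ^ 2 - b * s - a ≠ 0 := by
      intro hP
      have := hT (T v + (s - b) • v) s (by
        rw [map_add, map_smul, hab]
        match_scalars
        · linear_combination -hP
        · ring)
      exact one_ne_zero (hv1' (s - b) 1 (by rw [← this]; module)).2
    -- As `T - s` is invertible on the plane, `w` can be corrected by a plane vector to an
    -- eigenvector. On the plane `(T - s) (T - (b - s))` is the scalar `-(s ^ 2 - b s - a)`, which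
    -- gives the coefficients after clearing denominators.
    have := hT ((s ^ 2 - b * s - a) • w - (p * (b - s) - a * q) • v - (-s * q - p) • T v) s (by
      rw [map_sub, map_sub, map_smul, map_smul, map_smul, hab, hs]
      module)
    refine hP (linearIndependent_triple_iff.1 hw (-(p * (b - s) - a * q)) (-(-s * q - p))
      (s ^ 2 - b * s - a) ?_).2.2
    rw [← this]
    module
  obtain ⟨α, β, γ, h3⟩ := exists_eq_of_linearIndependent_triple hv2 (T (T (T v)))
  refine isNamed_of_frame (F := F) (X := .o17) ⟨α, β, γ, fun t ht => ?_, rfl⟩ hf hv2 hd ?_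
  -- A root `t` makes `-t` a root of the characteristic polynomial `x ^ 3 - γ x ^ 2 - β x - α`; its
  -- quotient by `x + t`, applied to `v`, is an eigenvector.
  · have := hT (T (T v) + (-t - γ) • T v + (t ^ 2 + γ * t - β) • v) (-t) (by
      simp only [map_add, map_smul, h3]
      match_scalars <;> first | ring1 | linear_combination ht)
    exact one_ne_zero (linearIndependent_triple_iff.1 hv2 (t ^ 2 + γ * t - β) (-t - γ) 1
      (by rw [← this]; module)).2.2
  · rintro M (rfl | rfl | rfl)
    · simpa using hU v
    · simpa using hU (T v)
    · have := hU (T (T v))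
      rw [h3] at this
      convert this using 1
      simp [TensorProduct.tmul_add]
      module


end DimThree

/-! ### Dimension three: graphs of an endomorphism with a kernel vector -/

section Eigenvector

variable {F : Type*} [Field F]

/-- Modulo `h` every vector is an eigenvector, so `T` induces a scalar `b` on the quotient. For `b =
0` the image of `T` lies in the line of `h` (`o3` or `o9`); for `b ≠ 0`, `T` is diagonalisable with
eigenvalues `0, b, b` (`o8`). -/
theorem exists_isNamed_of_not_cyclic {U : Submodule F (V23 F)}
    (hd : Module.finrank F U = 3) {f₁ f₂ : Fin 2 → F} (hf : LinearIndependent F ![f₁, f₂])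
    (T : (Fin 3 → F) →ₗ[F] (Fin 3 → F)) (hU : ∀ v, f₁ ⊗ₜ[F] v + f₂ ⊗ₜ[F] T v ∈ U)
    {h : Fin 3 → F} (hh : h ≠ 0) (hT : T h = 0)
    (hc : ∀ y, LinearIndependent F ![h, y] → ∃ a b : F, T y = a • h + b • y) :
    ∃ X, IsNamed U X := by
  obtain ⟨y, z, hli⟩ := exists_linearIndependent_triple_of_ne_zero hh
  have hli' := linearIndependent_triple_iff.1 hli
  obtain ⟨l, a, hy⟩ := hc y <| LinearIndependent.pair_iff.2 fun a b e => by
    have := hli' a b 0 (by rw [← e]; module)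
    exact ⟨this.1, this.2.1⟩
  obtain ⟨m, b, hz⟩ := hc z <| LinearIndependent.pair_iff.2 fun a b e => by
    have := hli' a 0 b (by rw [← e]; module)
    exact ⟨this.1, this.2.2⟩
  obtain ⟨n, c, hyz⟩ := hc (y + z) <| LinearIndependent.pair_iff.2 fun a b e => by
    have := hli' a b b (by rw [← e]; module)
    exact ⟨this.1, this.2.1⟩
  -- The eigenvalues modulo `h` of `y` and `z` both equal that of `y + z`.
  obtain rfl : b = a := by
    rw [map_add, hy, hz] at hyz
    have := hli' (l + m - n) (a - c) (b - c) (by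
      rw [← sub_eq_zero] at hyz; rw [← hyz]; module)
    rw [sub_eq_zero.1 this.2.1, sub_eq_zero.1 this.2.2]
  have hUh := hU h
  rw [hT, TensorProduct.tmul_zero, add_zero] at hUh
  by_cases hb : b = 0
  · subst hb
    rw [zero_smul, add_zero] at hy hz
    have hUy := hU y
    have hUz := hU z
    rw [hy] at hUy
    rw [hz] at hUz
    by_cases hl : l = 0
    · subst hl
      by_cases hm : m = 0
      · subst hm
        refine ⟨.o3, isNamed_of_frame (F := F) (X := .o3) rfl hf hli hd ?_⟩
        rintro M (rfl | rfl | rfl)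
        · simpa using hUh
        · simpa using hUy
        · simpa using hUz
      · refine ⟨.o9, isNamed_of_frame (F := F) (X := .o9) (f := ![f₂, f₁]) (h := ![m • h, y, z])
          rfl ?_ ?_ hd ?_⟩
        · exact linearIndependent_pair_of_det_ne_zero hf 0 1 1 0 (by simp) (by simp) (by simp)
        · exact linearIndependent_triple_of_det_ne_zero hli m 0 0 0 1 0 0 0 1 (by simpa)
            (by simp) (by simp) (by simp)
        · rintro M (rfl | rfl | rfl)
          · simpa using U.smul_mem m hUh
          · simpa using hUy
          · simpa [add_comm] using hUz
    · refine ⟨.o9, isNamed_of_frame (F := F) (X := .o9) (f := ![f₂, f₁])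
        (h := ![l • h, l • z - m • y, y]) rfl ?_ ?_ hd ?_⟩
      · exact linearIndependent_pair_of_det_ne_zero hf 0 1 1 0 (by simp) (by simp) (by simp)
      · exact linearIndependent_triple_of_det_ne_zero hli l 0 0 0 (-m) l 0 1 0 (by simpa)
          (by simp) (by module) (by simp)
      · rintro M (rfl | rfl | rfl)
        · simpa using U.smul_mem l hUh
        · convert U.sub_mem (U.smul_mem l hUz) (U.smul_mem m hUy) using 1
          simp [TensorProduct.tmul_sub]
          module
        · simpa [add_comm] using hUy
  · refine ⟨.o8, isNamed_of_frame (F := F) (X := .o8) (f := ![f₁, f₁ + b • f₂])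
      (h := ![h, y + (l / b) • h, z + (m / b) • h]) rfl ?_ ?_ hd ?_⟩
    · exact linearIndependent_pair_of_det_ne_zero hf 1 0 1 b (by simpa) (by simp) (by simp)
    · exact linearIndependent_triple_of_det_ne_zero hli 1 0 0 (l / b) 1 0 (m / b) 0 1 (by simp)
        (by simp) (by module) (by module)
    · rintro M (rfl | rfl | rfl)
      · simpa using hUh
      · have := hU (y + (l / b) • h)
        rw [map_add, map_smul, hT, hy] at this
        convert this using 1
        simp [TensorProduct.add_tmul, TensorProduct.tmul_add, ← TensorProduct.smul_tmul']
        match_scalars <;> field_simp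
      · have := hU (z + (m / b) • h)
        rw [map_add, map_smul, hT, hz] at this
        convert this using 1
        simp [TensorProduct.add_tmul, TensorProduct.tmul_add, ← TensorProduct.smul_tmul']
        match_scalars <;> field_simp

/-- The map induced on the quotient by `h` has eigenvalues `0` and `r`. For `r = 0`, `T` is
nilpotent of rank one (`o9`) or two (`o16`); for `r ≠ 0`, the eigenvalue `0` is semisimple (`o8`) or
has a Jordan block of size two (`o13`), according to `p`. -/
theorem exists_isNamed_of_cyclic_of_singular {U : Submodule F (V23 F)}
    (hd : Module.finrank F U = 3) {f₁ f₂ : Fin 2 → F} (hf : LinearIndependent F ![f₁, f₂])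
    (T : (Fin 3 → F) →ₗ[F] (Fin 3 → F)) (hU : ∀ v, f₁ ⊗ₜ[F] v + f₂ ⊗ₜ[F] T v ∈ U)
    {h y w : Fin 3 → F} (hT : T h = 0) (hli : LinearIndependent F ![h, y, w]) (hy : T y = w)
    {p r : F} (hw : T w = p • h + r • w) : ∃ X, IsNamed U X := by
  have hUh := hU h
  rw [hT, TensorProduct.tmul_zero, add_zero] at hUh
  have hUy := hU y
  rw [hy] at hUy
  have hUw := hU w
  rw [hw] at hUw
  by_cases hr : r = 0
  · subst hr
    rw [zero_smul, add_zero] at hUw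
    by_cases hp : p = 0
    · subst hp
      refine ⟨.o9, isNamed_of_frame (F := F) (X := .o9) (f := ![f₂, f₁]) (h := ![w, h, y])
        rfl ?_ ?_ hd ?_⟩
      · exact linearIndependent_pair_of_det_ne_zero hf 0 1 1 0 (by simp) (by simp) (by simp)
      · exact linearIndependent_triple_of_det_ne_zero hli 0 0 1 1 0 0 0 1 0 (by simp)
          (by simp) (by simp) (by simp)
      · rintro M (rfl | rfl | rfl)
        · simpa using hUw
        · simpa using hUh
        · simpa [add_comm] using hUy
    · refine ⟨.o16, isNamed_of_frame (F := F) (X := .o16) (h := ![y, w, p • h])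
        rfl hf ?_ hd ?_⟩
      · exact linearIndependent_triple_of_det_ne_zero hli 0 1 0 0 0 1 p 0 0 (by simpa)
          (by simp) (by simp) (by simp)
      · rintro M (rfl | rfl | rfl)
        · simpa using hUy
        · simpa using hUw
        · simpa using U.smul_mem p hUh
  · by_cases hp : p = 0
    · subst hp
      rw [zero_smul, zero_add] at hUw
      refine ⟨.o8, isNamed_of_frame (F := F) (X := .o8) (f := ![f₁ + r • f₂, f₁])
        (h := ![w, h, r • y - w]) rfl ?_ ?_ hd ?_⟩
      · exact linearIndependent_pair_of_det_ne_zero hf 1 r 1 0 (by simpa) (by simp) (by simp)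
      · exact linearIndependent_triple_of_det_ne_zero hli 0 0 1 1 0 0 0 r (-1) (by simpa)
          (by simp) (by simp) (by module)
      · rintro M (rfl | rfl | rfl)
        · simpa [TensorProduct.add_tmul, TensorProduct.smul_tmul] using hUw
        · simpa using hUh
        · convert U.sub_mem (U.smul_mem r hUy) hUw using 1
          simp [TensorProduct.tmul_sub]
    -- Here `r • w + p • h` is an eigenvector for `r`, while `T` maps `r ^ 2 • y - r • w` to `-(r p)
    -- • h`, giving the Jordan block at `0`.
    · refine ⟨.o13, isNamed_of_frame (F := F) (X := .o13) (f := ![f₁, f₁ + r • f₂])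
        (h := ![r ^ 2 • y - r • w, -(p • h), r • w + p • h]) rfl ?_ ?_ hd ?_⟩
      · exact linearIndependent_pair_of_det_ne_zero hf 1 0 1 r (by simpa) (by simp) (by simp)
      · exact linearIndependent_triple_of_det_ne_zero hli 0 (r ^ 2) (-r) (-p) 0 0 p 0 r
          (by simp [hp, hr]) (by module) (by module) (by module)
      · rintro M (rfl | rfl | rfl)
        · convert U.sub_mem (U.sub_mem (U.smul_mem (r ^ 2) hUy) (U.smul_mem r hUw))
            (U.smul_mem p hUh) using 1
          simp [TensorProduct.add_tmul, TensorProduct.tmul_sub, TensorProduct.tmul_add,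
            TensorProduct.tmul_neg, ← TensorProduct.smul_tmul']
          module
        · simpa [TensorProduct.tmul_neg] using U.smul_mem p hUh
        · convert U.add_mem (U.smul_mem r hUw) (U.smul_mem p hUh) using 1
          simp [TensorProduct.add_tmul, TensorProduct.tmul_add, ← TensorProduct.smul_tmul']
          module

/-- The span of `y, w` is an invariant complement of `h`, with characteristic polynomial `x ^ 2 - r
x - q` and `q ≠ 0`. A double root, two distinct roots or no root give `o13`, `o14` or `o15`. -/
theorem exists_isNamed_of_cyclic_of_nonsingular {U : Submodule F (V23 F)}
    (hd : Module.finrank F U = 3) {f₁ f₂ : Fin 2 → F} (hf : LinearIndependent F ![f₁, f₂])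
    (T : (Fin 3 → F) →ₗ[F] (Fin 3 → F)) (hU : ∀ v, f₁ ⊗ₜ[F] v + f₂ ⊗ₜ[F] T v ∈ U)
    {h y w : Fin 3 → F} (hT : T h = 0) (hli : LinearIndependent F ![h, y, w]) (hy : T y = w)
    {q r : F} (hq : q ≠ 0) (hw : T w = q • y + r • w) : ∃ X, IsNamed U X := by
  have hUh := hU h
  rw [hT, TensorProduct.tmul_zero, add_zero] at hUh
  have hUy := hU y
  rw [hy] at hUy
  have hUw := hU w
  rw [hw] at hUw
  by_cases hroot : ∃ b, b ^ 2 - r * b - q = 0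
  · obtain ⟨b, hb⟩ := hroot
    obtain ⟨c, rfl⟩ : ∃ c, r = b + c := ⟨r - b, by ring⟩
    obtain rfl : q = -(b * c) := by linear_combination -hb
    clear hb
    have hb0 : b ≠ 0 := by rintro rfl; simp at hq
    have hc0 : c ≠ 0 := by rintro rfl; simp at hq
    by_cases hbc : b = c
    · subst hbc
      refine ⟨.o13, isNamed_of_frame (F := F) (X := .o13) (f := ![f₁ + b • f₂, f₁])
        (h := ![-w, w - b • y, h]) rfl ?_ ?_ hd ?_⟩
      · exact linearIndependent_pair_of_det_ne_zero hf 1 b 1 0 (by simpa) (by simp) (by simp)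
      · exact linearIndependent_triple_of_det_ne_zero hli 0 0 (-1) 0 (-b) 1 1 0 0 (by simpa)
          (by simp) (by module) (by simp)
      · rintro M (rfl | rfl | rfl)
        · convert U.smul_mem (-b) hUy using 1
          simp [TensorProduct.add_tmul, TensorProduct.tmul_sub, TensorProduct.tmul_neg,
            ← TensorProduct.smul_tmul']
          module
        · convert U.sub_mem hUw (U.smul_mem b hUy) using 1
          simp [TensorProduct.add_tmul, TensorProduct.tmul_sub, TensorProduct.tmul_add,
            TensorProduct.tmul_neg, ← TensorProduct.smul_tmul']
          module
        · simpa using hUh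
    · have hcb : c - b ≠ 0 := sub_ne_zero.2 (Ne.symm hbc)
      -- `w - c • y` and `w - b • y` are eigenvectors for `b` and `c`. The vectors of `f` are scaled
      -- so that their sum is `c • (f₁ + b • f₂)`, the row direction of the eigenvalue `b`.
      refine ⟨.o14, isNamed_of_frame (F := F) (X := .o14)
        (f := ![(c - b) • f₁, b • (f₁ + c • f₂)]) (h := ![h, w - c • y, w - b • y])
        rfl ?_ ?_ hd ?_⟩
      · exact linearIndependent_pair_of_det_ne_zero hf (c - b) 0 b (b * c)
          (by simp [hcb, hb0, hc0]) (by simp) (by module)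
      · exact linearIndependent_triple_of_det_ne_zero hli 1 0 0 0 (-c) 1 0 (-b) 1
          (by contrapose! hcb; linear_combination -hcb) (by simp) (by module) (by module)
      · rintro M (rfl | rfl | rfl)
        · simpa [← TensorProduct.smul_tmul'] using U.smul_mem (c - b) hUh
        · convert U.smul_mem c (U.sub_mem hUw (U.smul_mem c hUy)) using 1
          simp [TensorProduct.add_tmul, TensorProduct.tmul_sub, TensorProduct.tmul_add,
            TensorProduct.tmul_neg, ← TensorProduct.smul_tmul']
          module
        · convert U.smul_mem b (U.sub_mem hUw (U.smul_mem b hUy)) using 1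
          simp [TensorProduct.add_tmul, TensorProduct.tmul_sub, TensorProduct.tmul_add,
            TensorProduct.tmul_neg, ← TensorProduct.smul_tmul']
          module
  -- A root `t` of the quadratic attached to these parameters would make `-t⁻¹` a root of `x ^ 2 - r
  -- x - q`.
  · refine ⟨.o15, isNamed_of_frame (F := F) (X := .o15) (h := ![y + (r / q) • w, w, h])
      ⟨-(r / q), q, ⟨hq, fun t ht => hroot ⟨-t⁻¹, ?_⟩⟩, rfl⟩ hf ?_ hd ?_⟩
    · have ht0 : t ≠ 0 := by rintro rfl; simp at ht
      field_simp at ht ⊢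
      linear_combination -ht
    · exact linearIndependent_triple_of_det_ne_zero hli 0 1 (r / q) 0 0 1 1 0 0 (by simp)
        (by module) (by simp) (by simp)
    · rintro M (rfl | rfl | rfl)
      · convert hUy using 1
        simp [TensorProduct.tmul_add]
        module
      · convert hUw using 1
        simp only [map_add, map_smul, frameMap_E, Matrix.cons_val_zero, Matrix.cons_val_one,
          TensorProduct.tmul_add, TensorProduct.tmul_smul]
        match_scalars <;> field_simp
      · simpa using hUh

end Eigenvector

/-! ### Assembling the classification; ranks over two elements -/

section Classification

variable {F : Type*} [Field F]

theorem exists_isNamed_of_kernel {U : Submodule F (V23 F)}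
    (hd : Module.finrank F U = 3) {f₁ f₂ : Fin 2 → F} (hf : LinearIndependent F ![f₁, f₂])
    (T : (Fin 3 → F) →ₗ[F] (Fin 3 → F)) (hU : ∀ v, f₁ ⊗ₜ[F] v + f₂ ⊗ₜ[F] T v ∈ U)
    {h : Fin 3 → F} (hh : h ≠ 0) (hT : T h = 0) : ∃ X, IsNamed U X := by
  by_cases hc : ∀ y, LinearIndependent F ![h, y] → ∃ a b : F, T y = a • h + b • y
  · exact exists_isNamed_of_not_cyclic hd hf T hU hh hT hc
  push Not at hc
  obtain ⟨y, hy, hTy⟩ := hc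
  have hli : LinearIndependent F ![h, y, T y] := by
    by_contra hli
    obtain ⟨a, b, e⟩ := eq_of_not_linearIndependent_triple hy hli
    exact hTy a b e
  obtain ⟨p, q, r, hw⟩ := exists_eq_of_linearIndependent_triple hli (T (T y))
  by_cases hq : q = 0
  · subst hq
    exact exists_isNamed_of_cyclic_of_singular hd hf T hU hT hli rfl (p := p) (r := r)
      (by rw [hw]; module)
  -- Since `T h = 0`, adding `(p / q) • h` to `y` keeps `T y` and absorbs the `h` component of `T (T
  -- y)`.
  · refine exists_isNamed_of_cyclic_of_nonsingular hd hf T hU (h := h) (y := y + (p / q) • h)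
      (w := T y) hT ?_ (by simp [hT]) hq (r := r) ?_
    · exact linearIndependent_triple_of_det_ne_zero hli 1 0 0 (p / q) 1 0 0 0 1 (by simp)
        (by simp) (by module) (by simp)
    · rw [hw]
      match_scalars <;> field_simp

theorem exists_isNamed_of_graph {U : Submodule F (V23 F)}
    (hd : Module.finrank F U = 3) {f₁ f₂ : Fin 2 → F} (hf : LinearIndependent F ![f₁, f₂])
    (T : (Fin 3 → F) →ₗ[F] (Fin 3 → F)) (hU : ∀ v, f₁ ⊗ₜ[F] v + f₂ ⊗ₜ[F] T v ∈ U) :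
    ∃ X, IsNamed U X := by
  by_cases hT : ∀ v, ∀ s : F, T v = s • v → v = 0
  · exact ⟨_, exists_isNamed_of_no_eigenvector hd hf T hU hT⟩
  push Not at hT
  obtain ⟨h, s, hs, hh⟩ := hT
  -- The graph is unchanged when `f₁` becomes `f₁ + s • f₂` and `T` becomes `T - s`, and the
  -- eigenvector becomes a kernel vector.
  refine exists_isNamed_of_kernel hd (f₁ := f₁ + s • f₂) (f₂ := f₂)
    (linearIndependent_pair_of_det_ne_zero hf 1 s 0 1 (by simp) (by simp) (by simp))
    (T - s • LinearMap.id) (fun v => ?_) hh (by simp [hs])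
  convert hU v using 1
  simp [TensorProduct.add_tmul, TensorProduct.tmul_sub, ← TensorProduct.smul_tmul']

/-- The first row map is injective on `U`, hence bijective onto `F^3`, so the second row is a linear
function `T` of the first. -/
theorem exists_isNamed_of_row_injective {U : Submodule F (V23 F)}
    (hd : Module.finrank F U = 3) {f₁ f₂ : Fin 2 → F} (hf : LinearIndependent F ![f₁, f₂])
    (hU : ∀ y, f₂ ⊗ₜ[F] y ∈ U → y = 0) : ∃ X, IsNamed U X := by
  obtain ⟨R₁, R₂, hR⟩ := exists_rows hf
  have hinj : Function.Injective (R₁ ∘ₗ U.subtype) := by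
    refine (injective_iff_map_eq_zero _).2 fun M hM => ?_
    have hM' : R₁ M = 0 := hM
    have h0 : (M : V23 F) = f₂ ⊗ₜ[F] R₂ M := by conv_lhs => rw [hR M, hM']; simp
    have h1 := hU _ (h0 ▸ M.2)
    rw [h1, TensorProduct.tmul_zero] at h0
    exact Subtype.ext h0
  have hsurj : LinearMap.range (R₁ ∘ₗ U.subtype) = ⊤ := Submodule.eq_top_of_finrank_eq <| by
    rw [LinearMap.finrank_range_of_inj hinj, hd, Module.finrank_fin_fun]
  let e : U ≃ₗ[F] (Fin 3 → F) := LinearEquiv.ofBijective (R₁ ∘ₗ U.subtype)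
    ⟨hinj, LinearMap.range_eq_top.1 hsurj⟩
  refine exists_isNamed_of_graph hd hf (R₂ ∘ₗ U.subtype ∘ₗ e.symm.toLinearMap) fun v => ?_
  have hv : R₁ (e.symm v) = v := e.apply_symm_apply v
  have := hR (e.symm v)
  rw [hv] at this
  exact this ▸ (e.symm v).2

theorem exists_isNamed_of_finrank_eq_three {U : Submodule F (V23 F)}
    (hd : Module.finrank F U = 3) : ∃ X, IsNamed U X := by
  set f₁ : Fin 2 → F := Pi.single 0 1
  set f₂ : Fin 2 → F := Pi.single 1 1
  have hf : LinearIndependent F ![f₁, f₂] := linearIndependent_single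
  by_cases h₁ : ∀ y, f₁ ⊗ₜ[F] y ∈ U → y = 0
  · exact exists_isNamed_of_row_injective hd (f₁ := f₂) (f₂ := f₁)
      (linearIndependent_pair_of_det_ne_zero hf 0 1 1 0 (by simp) (by simp) (by simp)) h₁
  by_cases h₂ : ∀ y, f₂ ⊗ₜ[F] y ∈ U → y = 0
  · exact exists_isNamed_of_row_injective hd hf h₂
  by_cases h₃ : ∀ y, (f₁ + f₂) ⊗ₜ[F] y ∈ U → y = 0
  · exact exists_isNamed_of_row_injective hd (f₁ := f₁) (f₂ := f₁ + f₂)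
      (linearIndependent_pair_of_det_ne_zero hf 1 0 1 1 (by simp) (by simp) (by simp)) h₃
  push Not at h₁ h₂ h₃
  obtain ⟨y₁, hU₁, hy₁⟩ := h₁
  obtain ⟨y₂, hU₂, hy₂⟩ := h₂
  obtain ⟨y₃, hU₃, hy₃⟩ := h₃
  exact exists_isNamed_of_three_tmul_mem hd hf hy₁ hy₂ hy₃ hU₁ hU₂ hU₃

theorem exists_isNamed_of_finrank_le_three {U : Submodule F (V23 F)}
    (hd : Module.finrank F U ≤ 3) : ∃ X, IsNamed U X := by
  interval_cases hn : Module.finrank F U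
  · obtain rfl := Submodule.finrank_eq_zero.1 hn
    exact ⟨.o0, ⊥, rfl, LinearEquiv.refl F _, LinearEquiv.refl F _, Submodule.map_bot _⟩
  · exact exists_isNamed_of_finrank_eq_one hn
  · exact exists_isNamed_of_finrank_eq_two hn
  · exact exists_isNamed_of_finrank_eq_three hn

/-- The name of the orthogonal space of a canonical subspace of dimension at most two. -/
def perpName : OrbitName → OrbitName
  | .o1 => .o1p
  | .o2 => .o2p
  | .o4 => .o4p
  | .o4T => .o4Tp
  | .o5 => .o5p
  | .o6 => .o6p
  | .o7 => .o7p
  | .o10 => .o10p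
  | .o11 => .o11p
  | _ => .o0p

/-- Among names of dimension at most two only `.o0` reaches the default branch of `perpName`, where
the value is correct. -/
theorem perp_mem_canonical {X : OrbitName} (hX : nameDim X ≤ 2) {C : Submodule F (V23 F)}
    (hC : C ∈ canonical F X) : perp F C ∈ canonical F (perpName X) := by
  cases X <;> first
    | (exfalso; revert hX; decide)
    | (obtain ⟨u, v, huv, rfl⟩ := hC; exact ⟨u, v, huv, rfl⟩)
    | (obtain rfl := hC; rfl)

theorem IsNamed.perp {U : Submodule F (V23 F)} {X : OrbitName} (h : IsNamed U X)
    (hX : nameDim X ≤ 2) : IsNamed (perp F U) (perpName X) := by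
  obtain ⟨C, hC, hU⟩ := h
  exact ⟨_, perp_mem_canonical hX hC, hU.perp⟩

theorem exists_isNamed (U : Submodule F (V23 F)) : ∃ X, IsNamed U X := by
  by_cases hd : Module.finrank F U ≤ 3
  · exact exists_isNamed_of_finrank_le_three hd
  · have hp := finrank_perp U
    obtain ⟨X, hX⟩ := exists_isNamed_of_finrank_le_three (U := perp F U) (by omega)
    have := hX.nameDim_eq
    exact ⟨perpName X, perp_perp U ▸ hX.perp (by omega)⟩

theorem hasRank_o17_five (h2 : ∀ x : F, x = 0 ∨ x = 1) {α β γ : F}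
    (h : AdmissibleCubic F α β γ) : HasRank (Submodule.span F {E F 0 0 + E F 1 1,
      E F 0 1 + E F 1 2, E F 0 2 + α • E F 1 0 + β • E F 1 1 + γ • E F 1 2}) 5 := by
  set C := Submodule.span F {E F 0 0 + E F 1 1,
      E F 0 1 + E F 1 2, E F 0 2 + α • E F 1 0 + β • E F 1 1 + γ • E F 1 2} with hC
  have hdC : Module.finrank F C = 3 := finrank_canonical (X := .o17) ⟨α, β, γ, h, rfl⟩
  refine ⟨spanned_o17_five α β γ, fun l hl => ?_⟩
  have hlt := hl.finrank_lt (entry 0 0) ⟨_, Submodule.subset_span (Or.inl rfl), by simp⟩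
    (entry_zero_zero_eq_zero_of_tmul_mem_o17 h)
  by_contra hl5
  obtain rfl : l = 4 := by omega
  obtain ⟨a, b, hab⟩ := hl
  set D := Submodule.span F (Set.range fun i => a i ⊗ₜ[F] b i) with hD
  have hDs : Spanned D 4 := ⟨a, b, le_rfl⟩
  -- If `D` had dimension three it would equal `C`, which would then be spanned by rank-one tensors
  -- with zero entry 00.
  have hdD : Module.finrank F D = 4 := by
    refine le_antisymm hDs.finrank_le (lt_of_le_of_ne (hdC ▸ Submodule.finrank_mono hab) ?_)
    intro hd
    have hCD : C = D := Submodule.eq_of_le_of_finrank_eq hab (hdC.trans hd)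
    have h0 : C ≤ LinearMap.ker (entry 0 0) := by
      conv_lhs => rw [hCD]
      refine Submodule.span_le.2 ?_
      rintro _ ⟨i, rfl⟩
      exact entry_zero_zero_eq_zero_of_tmul_mem_o17 h _ _ (hC ▸ hCD ▸ Submodule.subset_span ⟨i, rfl⟩)
    have h1 : entry 0 0 (E F 0 0 + E F 1 1) = 0 := h0 (Submodule.subset_span (Or.inl rfl))
    simp at h1
  have hdP : Module.finrank F (perp F D) = 2 := by rw [finrank_perp, hdD]
  -- `perp F D` is a plane inside `perp F C`, which contains no nonzero `a ⊗ b`. Taking `⊥` again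
  -- makes `D` itself of type `o10p` or `o11p`.
  have hP : IsNamed (perp F D) .o10 ∨ IsNamed (perp F D) .o11 :=
    exists_isNamed_of_tmul_notMem hdP fun a b hm =>
      tmul_eq_zero_of_mem_perp_o17 h (perp_anti hab hm)
  rcases hP with hP | hP
  · obtain ⟨C', ⟨u, v, huv, rfl⟩, hE⟩ := hP.perp (by decide)
    rw [perp_perp] at hE
    exact absurd ((hasRank_o10p huv).2 4 (hE.spanned hDs)) (by norm_num)
  · obtain ⟨C', rfl, hE⟩ := hP.perp (by decide)
    rw [perp_perp] at hE
    exact absurd ((hasRank_o11p_five h2).2 4 (hE.spanned hDs)) (by norm_num)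

theorem hasRank_of_card_ne_two (hF : Nat.card F ≠ 2) {X : OrbitName} {C : Submodule F (V23 F)}
    (hC : C ∈ canonical F X) : HasRank C (tableRank X) := by
  obtain ⟨c, h0, h1⟩ : ∃ c : F, c ≠ 0 ∧ c ≠ 1 := by
    by_contra! h
    refine hF ((Nat.card_eq_two_iff' (0 : F)).2 ⟨1, one_ne_zero, fun c hc => h c hc⟩)
  by_cases h17 : X = .o17
  · subst h17
    obtain ⟨α, β, γ, h, rfl⟩ := hC
    exact hasRank_o17_four h0 h1 h
  by_cases h11 : X = .o11p
  · subst h11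
    have hd := finrank_canonical hC
    obtain rfl := hC
    exact hasRank_of_finrank hd (spanned_o11p_four h0 h1)
  exact hasRank_canonical h17 h11 hC

theorem hasRank_of_card_eq_two (hF : Nat.card F = 2) {X : OrbitName} {C : Submodule F (V23 F)}
    (hC : C ∈ canonical F X) : HasRank C (tableRankTwo X) := by
  have h2 : ∀ x : F, x = 0 ∨ x = 1 := by
    obtain ⟨y, -, hy⟩ := (Nat.card_eq_two_iff' (0 : F)).1 hF
    intro x
    by_cases hx : x = 0
    · exact .inl hx
    · exact .inr ((hy x hx).trans (hy 1 one_ne_zero).symm)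
  by_cases h17 : X = .o17
  · subst h17
    obtain ⟨α, β, γ, h, rfl⟩ := hC
    exact hasRank_o17_five h2 h
  by_cases h11 : X = .o11p
  · subst h11
    obtain rfl := hC
    exact hasRank_o11p_five h2
  have hX : tableRankTwo X = tableRank X := by
    cases X <;> first | rfl | exact absurd rfl h17 | exact absurd rfl h11
  exact hX ▸ hasRank_canonical h17 h11 hC

/-! ### Transfer from subspaces back to tensors -/

variable {r : ℕ}

theorem exists_hOrbit_mem_orbitsNamed (A : V23r F r) :
    ∃ X, hOrbit A ∈ orbitsNamed F r X := by
  obtain ⟨X, C, hC, g₁, g₂, hg⟩ := exists_isNamed (contraction3 A)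
  refine ⟨X, hAct g₁ g₂ (LinearEquiv.refl F _) A, ?_, (hOrbit_hAct _ _ _ _).symm⟩
  rw [contraction3_hAct, hg]
  exact hC

theorem tensorRank_eq_of_orbitsNamed (hr : 1 ≤ r) {X : OrbitName} {k : ℕ}
    (hk : ∀ C ∈ canonical F X, HasRank C k) {O : Set (V23r F r)} (hO : O ∈ orbitsNamed F r X)
    {A : V23r F r} (hA : A ∈ O) : tensorRank A = k := by
  obtain ⟨B, hB, rfl⟩ := hO
  obtain ⟨g₁, g₂, g₃, rfl⟩ := hA
  refine tensorRank_eq_of_hasRank hr (Equivalent.hasRank ?_ (hk _ hB))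
  exact ⟨g₁, g₂, (contraction3_hAct g₁ g₂ g₃ B).symm⟩

end Classification

end Tensor23r

theorem mainTheorem9 {F : Type*} [Field F]
    (hF : Finite F ∨ IsAlgClosed F ∨ Nonempty (F ≃+* ℝ)) (r : ℕ) (hr : 1 ≤ r) :
    (∀ A : Tensor23r.V23r F r, ∃ X : Tensor23r.OrbitName,
      Tensor23r.hOrbit A ∈ Tensor23r.orbitsNamed F r X) ∧
    (Nat.card F ≠ 2 → ∀ X : Tensor23r.OrbitName, ∀ O ∈ Tensor23r.orbitsNamed F r X,
      ∀ A ∈ O, Tensor23r.tensorRank A = Tensor23r.tableRank X) ∧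
    (Nat.card F = 2 → ∀ X : Tensor23r.OrbitName, ∀ O ∈ Tensor23r.orbitsNamed F r X,
      ∀ A ∈ O, Tensor23r.tensorRank A = Tensor23r.tableRankTwo X) :=
  ⟨Tensor23r.exists_hOrbit_mem_orbitsNamed,
    fun h _ _ hO _ hA => Tensor23r.tensorRank_eq_of_orbitsNamed hr
      (fun _ hC => Tensor23r.hasRank_of_card_ne_two h hC) hO hA,
    fun h _ _ hO _ hA => Tensor23r.tensorRank_eq_of_orbitsNamed hr
      (fun _ hC => Tensor23r.hasRank_of_card_eq_two h hC) hO hA⟩
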